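/- **Conventions.** A 2-category is a strict 2-category and a 2-functor is a strict 2-functor; pseudofunctors (with invertible unit and composition constraints), pseudonatural transformations and modifications are the usual ones. Let $\mathcal C$ be a $(2,1)$-category (a 2-category all of whose 2-cells are invertible) and let $\mathcal D$ be a 2-category. An *arrowy 2-subcategory* $\mathcal A$ of $\mathcal C$ is a 2-subcategory with the same objects as $\mathcal C$, with a set of morphisms of $\mathcal C$ containing all identities and closed under composition, and with all 2-cells of $\mathcal C$ between these morphisms. Write $\mathcal D^{\mathrm{Ob}\,\mathcal C}$ for the 2-category of families of objects of $\mathcal D$ indexed by the objects of $\mathcal C$, with families of morphisms and families of 2-cells. For a pseudofunctor $F:\mathcal A\to\mathcal D$, a pseudonatural transformation $\alpha$ between such pseudofunctors, or a modification $\Xi$ between such transformations, write $|F|$, $|\alpha|$, $|\Xi|$ for the underlying family of values on objects, resp. of components. **Gluing data.** Let $\mathcal A_1,\dots,\mathcal A_n$ ($n\ge 1$) be arrowy 2-subcategories of $\mathcal C$. The 2-category $\mathrm{GD}_{\mathcal A_1,\dots,\mathcal A_n}(\mathcal C,\mathcal D)$ is defined as follows. An object is a pair $((F_i)_{1\le i\le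 n},(G_{ij})_{1\le i,j\le n})$, where $F_i:\mathcal A_i\to\mathcal D$ are pseudofunctors with $|F_1|=\dots=|F_n|$ and where $G_{ij}$ assigns to each square $D$ in $\mathcal C$, consisting of morphisms $b:X\to Y$, $a:Z\to W$ of $\mathcal A_i$, morphisms $q:X\to Z$, $p:Y\to W$ of $\mathcal A_j$ and a 2-cell $\alpha:aq\Rightarrow pb$, an invertible 2-cell $G_{ijD}:F_i(a)F_j(q)\Rightarrow F_j(p)F_i(b)$ of $\mathcal D$, such that: - (A) for all $i,j$ and every 2-cell $\alpha:a\Rightarrow b$ between morphisms $a,b:X\to Y$ of $\mathcal A_i$, if $D$ is the square with $q=\mathrm{id}_X$, $p=\mathrm{id}_Y$ given by $\alpha$, then $G_{ijD}$ corresponds to $F_i(\alpha)$ under the unit constraints $F_j(\mathrm{id}_X)\cong \mathrm{id}$, $F_j(\mathrm{id}_Y)\cong\mathrm{id}$; - (O) for all $i$ and every square $D$ with all four sides in $\mathcal A_i$, $G_{iiD}$ corresponds to $F_i(\alpha)$ under the composition constraints $F_i(a)F_i(q)\cong F_i(aq)$, $F_i(p)F_i(b)\cong F_i(pb)$; - (D)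 for all $i,j,k$ and every 2-commutative cube with a bottom face $K:aq\Rightarrow pb$, a top face $K':a'q'\Rightarrow p'b'$, and vertical edges $x:X'\to X$, $y:Y'\to Y$, $z:Z'\to Z$, $w:W'\to W$, where $a,b,a',b'$ are in $\mathcal A_i$, $p,q,p',q'$ in $\mathcal A_j$, $x,y,z,w$ in $\mathcal A_k$, and with right, left, front and back faces $I:py\Rightarrow wp'$, $I':qx\Rightarrow zq'$, $J:az\Rightarrow wa'$, $J':bx\Rightarrow yb'$, the two composites $$F_i(a)F_j(q)F_k(x)\xRightarrow{G_{jkI'}}F_i(a)F_k(z)F_j(q')\xRightarrow{G_{ikJ}}F_k(w)F_i(a')F_j(q')\xRightarrow{G_{ijK'}}F_k(w)F_j(p')F_i(b')$$ and $$F_i(a)F_j(q)F_k(x)\xRightarrow{G_{ijK}}F_j(p)F_i(b)F_k(x)\xRightarrow{G_{ikJ'}}F_j(p)F_k(y)F_i(b')\xRightarrow{G_{jkI}}F_k(w)F_j(p')F_i(b')$$ are equal. A morphism $((F_i),(G_{ij}))\to((F'_i),(G'_{ij}))$ is a family of pseudonatural transformations $\alpha_i:F_i\Rightarrow F'_i$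 with common components $\alpha_0=|\alpha_1|=\dots=|\alpha_n|$ such that, for all $i,j$ and every square $D$ as above, the two 2-cells $\alpha_0(W)F_i(a)F_j(q)\Rightarrow F'_j(p)F'_i(b)\alpha_0(X)$ given by $\alpha_i(a)$, $\alpha_j(q)$, $G'_{ijD}$ and by $G_{ijD}$, $\alpha_j(p)$, $\alpha_i(b)$ are equal. A 2-cell $(\alpha_i)\Rightarrow(\alpha'_i)$ is a family of modifications $\Xi_i:\alpha_i\Rightarrow\alpha'_i$ with $|\Xi_1|=\dots=|\Xi_n|$. The 2-category $\mathrm{GD}_{\mathcal A_1,\dots,\mathcal A_n}(\mathcal C,\mathcal D)$ is regarded as a 2-category over $\mathcal D^{\mathrm{Ob}\,\mathcal C}$ via the 2-functor $((F_i),(G_{ij}))\mapsto|F_1|$, $(\alpha_i)\mapsto|\alpha_1|$, $(\Xi_i)\mapsto|\Xi_1|$. **Reindexing.** Let $\phi:\{1,\dots,n\}\to\{1,\dots,m\}$ be a map and let $\mathcal B_1,\dots,\mathcal B_m$ be arrowy 2-subcategories of $\mathcal C$ with $\mathcal A_i\subseteq\mathcal B_{\phi(i)}$ for all $i$. The 2-functor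 $$Q^\phi:\mathrm{GD}_{\mathcal B_1,\dots,\mathcal B_m}(\mathcal C,\mathcal D)\to\mathrm{GD}_{\mathcal A_1,\dots,\mathcal A_n}(\mathcal C,\mathcal D)$$ is given by $((F_k),(G_{kl}))\mapsto((F_{\phi(i)}|_{\mathcal A_i}),(G_{\phi(i)\phi(j)}))$, $(\alpha_k)\mapsto(\alpha_{\phi(i)})$, $(\Xi_k)\mapsto(\Xi_{\phi(i)})$, the $G$, $\alpha$, $\Xi$ being restricted as well; it commutes with the 2-functors to $\mathcal D^{\mathrm{Ob}\,\mathcal C}$. **Quasi-inverses over a base.** Let $\mathcal E$ be a 2-category and let $P:\mathcal X\to\mathcal E$, $P':\mathcal X'\to\mathcal E$ be 2-functors. An $\mathcal E$-functor $\mathcal X\to\mathcal X'$ is a 2-functor $G$ with $P'G=P$. For $\mathcal E$-functors $G,H:\mathcal X\to\mathcal X'$, an $\mathcal E$-natural transformation is a pseudonatural transformation $\alpha:G\Rightarrow H$ with $P'*\alpha=\mathrm{id}_P$, and an $\mathcal E$-modification is a modification between such transformations whose image under $P'$ is the identity. An $\mathcal E$-natural equivalence is an $\mathcal E$-natural transformation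 that is an equivalence in the 2-category of $\mathcal E$-functors, $\mathcal E$-natural transformations and $\mathcal E$-modifications. The $\mathcal E$-functors $G:\mathcal X\to\mathcal X'$ and $H:\mathcal X'\to\mathcal X$ are $\mathcal E$-quasi-inverses of each other if there exist $\mathcal E$-natural equivalences $\mathrm{id}_{\mathcal X'}\Rightarrow GH$ and $HG\Rightarrow\mathrm{id}_{\mathcal X}$. **Proposition.** Let $\mathcal A_1,\dots,\mathcal A_n$ ($n\ge1$) be arrowy 2-subcategories of a $(2,1)$-category $\mathcal C$ and let $\mathcal D$ be a 2-category. Let $\phi:\{1,\dots,n\}\to\{1,\dots,m\}$ be a map with a section $\phi'$, i.e. a map $\phi':\{1,\dots,m\}\to\{1,\dots,n\}$ with $\phi\phi'=\mathrm{id}$, and assume that $\mathcal A_i\subseteq\mathcal A_{\phi'\phi(i)}$ for all $1\le i\le n$. Then $$Q^\phi:\mathrm{GD}_{\mathcal A_{\phi'(1)},\dots,\mathcal A_{\phi'(m)}}(\mathcal C,\mathcal D)\to\mathrm{GD}_{\mathcal A_1,\dots,\mathcal A_n}(\mathcal C,\mathcal D)$$ and $$Q^{\phi'}:\mathrm{GD}_{\mathcal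 A_1,\dots,\mathcal A_n}(\mathcal C,\mathcal D)\to\mathrm{GD}_{\mathcal A_{\phi'(1)},\dots,\mathcal A_{\phi'(m)}}(\mathcal C,\mathcal D)$$ are $\mathcal D^{\mathrm{Ob}\,\mathcal C}$-quasi-inverses of each other. -/

import Mathlib

open CategoryTheory Bicategory
open scoped Pseudofunctor.StrongTrans

universe w₁ w₂ w₃ w₄ v₁ v₂ v₃ v₄ u₁ u₂ u₃ u₄ t t'

namespace Gluing

/-! ### Categories over a base 2-category

A 2-category is a `Bicategory` which is `Bicategory.Strict`, a (strict) 2-functor is a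
`StrictPseudofunctor`, a pseudonatural transformation is a `Pseudofunctor.StrongTrans`, and
a (2,1)-category is a 2-category which is `Bicategory.IsLocallyGroupoid`. -/

section Over

/-- A strict 2-functor is determined by its action on objects, morphisms and 2-cells. -/
theorem strictPseudofunctor_ext {B : Type u₂} [Bicategory.{w₂, v₂} B]
    {C : Type u₃} [Bicategory.{w₃, v₃} C] {F G : StrictPseudofunctor B C}
    (h : F.toPrelaxFunctor = G.toPrelaxFunctor) : F = G := by
  obtain ⟨⟨⟨F, mi, mc, _, _, _, _, _⟩, hi, hi'⟩, hc, hc'⟩ := F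
  obtain ⟨⟨⟨G, ni, nc, _, _, _, _, _⟩, ki, ki'⟩, kc, kc'⟩ := G
  obtain rfl : F = G := h
  obtain rfl : mi = ni := funext fun X => (hi' X).trans (ki' X).symm
  obtain rfl : @mc = @nc := by
    funext X Y Z f g
    exact (hc' f g).trans (kc' f g).symm
  rfl

variable {D : Type u₁} [Bicategory.{w₁, v₁} D] [Strict D]
  {B : Type u₂} [Bicategory.{w₂, v₂} B] [Strict B]
  {C : Type u₃} [Bicategory.{w₃, v₃} C] [Strict C]

/-- Let `(B, E)` and `(C, F)` be 2-categories over `D`, i.e. `E : B ⥤ D` and `F : C ⥤ D` are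
2-functors. A `D`-functor `(B, E) → (C, F)` is a 2-functor `G : B → C` such that `F G = E`. -/
structure OverFunctor (E : StrictPseudofunctor B D) (F : StrictPseudofunctor C D) where
  /-- the underlying 2-functor -/
  functor : StrictPseudofunctor B C
  comm : functor.comp F = E

namespace OverFunctor

/-- The identity `D`-functor. -/
def id (F : StrictPseudofunctor C D) : OverFunctor F F where
  functor := StrictPseudofunctor.id C
  comm := strictPseudofunctor_ext rfl

/-- The composition of `D`-functors. -/
def comp {B' : Type u₄} [Bicategory.{w₄, v₄} B'] [Strict B']
    {E : StrictPseudofunctor B D} {F : StrictPseudofunctor C D} {F' : StrictPseudofunctor B' D}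
    (G : OverFunctor E F) (H : OverFunctor F F') : OverFunctor E F' where
  functor := G.functor.comp H.functor
  comm := by
    have h : (G.functor.comp H.functor).comp F' = G.functor.comp (H.functor.comp F') :=
      strictPseudofunctor_ext rfl
    rw [h, H.comm, G.comm]

variable {E : StrictPseudofunctor B D} {F : StrictPseudofunctor C D}

/-- The underlying pseudofunctor of a `D`-functor. -/
abbrev toPs (G : OverFunctor E F) : Pseudofunctor B C :=
  G.functor.toStrictlyUnitaryPseudofunctor.toPseudofunctor

variable {G H : OverFunctor E F}

/-- A pseudonatural transformation `α : G ⇒ H` between `D`-functors is `D`-natural if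
`F * α : F G ⇒ F H` is the identity of `E = F G = F H`: its components are identities and so are
its naturality constraints. (The equality is heterogeneous since `F G X = E X = F H X`,
`F (G f) ≫ 𝟙 = E f = 𝟙 ≫ F (H f)` are not definitional equalities.) -/
structure IsOverNatural (α : G.toPs ⟶ H.toPs) : Prop where
  map_app (X : B) : HEq (F.map (α.app X)) (𝟙 (E.obj X))
  map₂_naturality {X Y : B} (f : X ⟶ Y) :
    HEq (F.map₂ (α.naturality f).hom) (𝟙 (E.map f))

/-- A modification between `D`-natural transformations is a `D`-modification if its image under
`F` is the identity modification of the identity of `E`. -/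
def IsOverModification {α β : G.toPs ⟶ H.toPs} (Γ : α ⟶ β) : Prop :=
  ∀ X : B, HEq (F.map₂ (Γ.as.app X)) (𝟙 (𝟙 (E.obj X)))

/-- A `D`-natural equivalence is a `D`-natural transformation which is an equivalence in the
2-category of `D`-functors, `D`-natural transformations and `D`-modifications. -/
def IsOverNaturalEquivalence (α : G.toPs ⟶ H.toPs) : Prop :=
  IsOverNatural α ∧ ∃ β : H.toPs ⟶ G.toPs, IsOverNatural β ∧
    ∃ (e : α ≫ β ≅ 𝟙 G.toPs) (e' : β ≫ α ≅ 𝟙 H.toPs),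
      IsOverModification (G := G) (H := G) e.hom ∧ IsOverModification (G := G) (H := G) e.inv ∧
      IsOverModification (G := H) (H := H) e'.hom ∧ IsOverModification (G := H) (H := H) e'.inv

/-- Two `D`-functors `G : (B, E) → (C, F)` and `H : (C, F) → (B, E)` are `D`-quasi-inverses of
each other if there exist `D`-natural equivalences `1_C ⇒ G H` and `H G ⇒ 1_B`. -/
def AreQuasiInverse (G : OverFunctor E F) (H : OverFunctor F E) : Prop :=
  (∃ α : (OverFunctor.id F).toPs ⟶ (H.comp G).toPs,
    IsOverNaturalEquivalence (G := OverFunctor.id F) (H := H.comp G) α) ∧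
  (∃ α : (G.comp H).toPs ⟶ (OverFunctor.id E).toPs,
    IsOverNaturalEquivalence (G := G.comp H) (H := OverFunctor.id E) α)

end OverFunctor

end Over

/-! ### The 2-category `D^S` for a set `S` -/

section Pow

/-- The objects of the 2-category `D^S`: families of objects of `D` indexed by `S`. -/
structure Pow (D : Type u₂) (S : Type u₁) where
  /-- the members of the family -/
  obj : S → D

namespace Pow

variable {D : Type u₂} [Bicategory.{w₂, v₂} D] {S : Type u₁}

/-- The morphisms of `D^S`: families of morphisms of `D`. -/
@[ext]
structure Hom (F F' : Pow D S) where
  /-- the members of the family -/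
  app (X : S) : F.obj X ⟶ F'.obj X

/-- The 2-cells of `D^S`: families of 2-cells of `D`. -/
@[ext]
structure Hom₂ {F F' : Pow D S} (f g : Hom F F') where
  /-- the members of the family -/
  app (X : S) : f.app X ⟶ g.app X

instance : CategoryStruct.{max u₁ v₂} (Pow D S) where
  Hom F F' := Hom F F'
  id F := ⟨fun X => 𝟙 (F.obj X)⟩
  comp f g := ⟨fun X => f.app X ≫ g.app X⟩

instance (F F' : Pow D S) : Category.{max u₁ w₂} (F ⟶ F') where
  Hom f g := Hom₂ f g
  id f := ⟨fun X => 𝟙 (f.app X)⟩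
  comp η θ := ⟨fun X => η.app X ≫ θ.app X⟩
  id_comp _ := Hom₂.ext (funext fun _ => Category.id_comp _)
  comp_id _ := Hom₂.ext (funext fun _ => Category.comp_id _)
  assoc _ _ _ := Hom₂.ext (funext fun _ => Category.assoc _ _ _)

/-- An invertible 2-cell from a family of invertible 2-cells. -/
def isoMk {F F' : Pow D S} {f g : F ⟶ F'} (e : ∀ X, f.app X ≅ g.app X) : f ≅ g where
  hom := ⟨fun X => (e X).hom⟩
  inv := ⟨fun X => (e X).inv⟩
  hom_inv_id := Hom₂.ext (funext fun X => (e X).hom_inv_id)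
  inv_hom_id := Hom₂.ext (funext fun X => (e X).inv_hom_id)

instance : Bicategory.{max u₁ w₂, max u₁ v₂} (Pow D S) where
  homCategory _ _ := inferInstance
  whiskerLeft f _ _ η := ⟨fun X => f.app X ◁ η.app X⟩
  whiskerRight η h := ⟨fun X => η.app X ▷ h.app X⟩
  associator f g h := isoMk fun X => α_ (f.app X) (g.app X) (h.app X)
  leftUnitor f := isoMk fun X => λ_ (f.app X)
  rightUnitor f := isoMk fun X => ρ_ (f.app X)
  whiskerLeft_id _ _ := Hom₂.ext (funext fun _ => whiskerLeft_id _ _)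
  whiskerLeft_comp _ _ _ _ _ _ := Hom₂.ext (funext fun _ => whiskerLeft_comp _ _ _)
  id_whiskerLeft _ := Hom₂.ext (funext fun _ => id_whiskerLeft _)
  comp_whiskerLeft _ _ _ _ _ := Hom₂.ext (funext fun _ => comp_whiskerLeft _ _ _)
  id_whiskerRight _ _ := Hom₂.ext (funext fun _ => id_whiskerRight _ _)
  comp_whiskerRight _ _ _ := Hom₂.ext (funext fun _ => comp_whiskerRight _ _ _)
  whiskerRight_id _ := Hom₂.ext (funext fun _ => whiskerRight_id _)
  whiskerRight_comp _ _ _ := Hom₂.ext (funext fun _ => whiskerRight_comp _ _ _)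
  whisker_assoc _ _ _ _ _ := Hom₂.ext (funext fun _ => whisker_assoc _ _ _)
  whisker_exchange _ _ := Hom₂.ext (funext fun _ => whisker_exchange _ _)
  pentagon _ _ _ _ := Hom₂.ext (funext fun _ => pentagon _ _ _ _)
  triangle _ _ := Hom₂.ext (funext fun _ => triangle _ _)

/-- A 2-cell of `D^S` whose components are given by equalities is given by an equality. -/
theorem eq_eqToIso {F F' : Pow D S} {f g : F ⟶ F'} (e : f ≅ g) (h : f = g)
    (he : ∀ X, e.hom.app X = eqToHom (by rw [h])) : e = eqToIso h := by
  subst h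
  exact Iso.ext (Hom₂.ext (funext fun X => he X))

instance [Strict D] : Strict (Pow D S) where
  id_comp f := Hom.ext (funext fun X => Strict.id_comp (Hom.app f X))
  comp_id f := Hom.ext (funext fun X => Strict.comp_id (Hom.app f X))
  assoc f g h :=
    Hom.ext (funext fun X => Strict.assoc (Hom.app f X) (Hom.app g X) (Hom.app h X))
  leftUnitor_eqToIso f := eq_eqToIso _ _ fun X =>
    congrArg Iso.hom (Strict.leftUnitor_eqToIso (Hom.app f X))
  rightUnitor_eqToIso f := eq_eqToIso _ _ fun X =>
    congrArg Iso.hom (Strict.rightUnitor_eqToIso (Hom.app f X))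
  associator_eqToIso f g h := eq_eqToIso (F := _) (F' := _) (α_ f g h) _ fun X =>
    congrArg Iso.hom (Strict.associator_eqToIso (Hom.app f X) (Hom.app g X) (Hom.app h X))

end Pow

end Pow

/-! ### Arrowy 2-subcategories -/

/-- An arrowy 2-subcategory of `C`: it has the same objects as `C`, some of the morphisms, and all
2-cells between these morphisms. It is determined by its set of morphisms, which contains the
identities and is closed under composition. -/
structure ArrowySubcategory (C : Type u₁) [Bicategory.{w₁, v₁} C] where
  /-- the morphisms of the 2-subcategory -/
  mem : MorphismProperty C
  id_mem (X : C) : mem (𝟙 X)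
  comp_mem {X Y Z : C} (f : X ⟶ Y) (g : Y ⟶ Z) : mem f → mem g → mem (f ≫ g)

namespace ArrowySubcategory

variable {C : Type u₁} [Bicategory.{w₁, v₁} C]

/-- Inclusion of arrowy 2-subcategories. -/
instance : LE (ArrowySubcategory C) where
  le A B := ∀ ⦃X Y : C⦄ (f : X ⟶ Y), A.mem f → B.mem f

theorem le_refl (A : ArrowySubcategory C) : A ≤ A := fun _ _ _ h => h

/-- The morphisms of the 2-category `A`. The 2-cells from `f` to `g` are the 2-cells from `f.hom`
to `g.hom` in `C`. -/
structure Hom (A : ArrowySubcategory C) (X Y : C) where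
  /-- the underlying morphism -/
  hom : X ⟶ Y
  mem : A.mem hom

/-- The identity morphism of `X` in `A`. -/
abbrev id (A : ArrowySubcategory C) (X : C) : A.Hom X X := ⟨𝟙 X, A.id_mem X⟩

/-- Composition of morphisms in `A`. -/
abbrev Hom.comp {A : ArrowySubcategory C} {X Y Z : C} (f : A.Hom X Y) (g : A.Hom Y Z) :
    A.Hom X Z :=
  ⟨f.hom ≫ g.hom, A.comp_mem _ _ f.mem g.mem⟩

/-- The inclusion of `A` into a larger arrowy 2-subcategory. -/
abbrev Hom.incl {A B : ArrowySubcategory C} (h : A ≤ B) {X Y : C} (f : A.Hom X Y) : B.Hom X Y :=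
  ⟨f.hom, h _ f.mem⟩

end ArrowySubcategory

/-! ### Pseudofunctors and pseudonatural transformations with prescribed object parts -/

section PrescribedObj

variable {C : Type u₁} [Bicategory.{w₁, v₁} C] {D : Type u₂} [Bicategory.{w₂, v₂} D]

/-- A pseudofunctor `A → D` whose map on objects is the given map `obj`. The fields are those of
`CategoryTheory.Pseudofunctor`. -/
structure PseudofunctorOn (A : ArrowySubcategory C) (obj : C → D) where
  /-- action on morphisms -/
  map {X Y : C} (f : A.Hom X Y) : obj X ⟶ obj Y
  /-- action on 2-cells -/
  map₂ {X Y : C} {f g : A.Hom X Y} (η : f.hom ⟶ g.hom) : map f ⟶ map g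
  /-- the unit constraint -/
  mapId (X : C) : map (A.id X) ≅ 𝟙 (obj X)
  /-- the composition constraint -/
  mapComp {X Y Z : C} (f : A.Hom X Y) (g : A.Hom Y Z) : map (f.comp g) ≅ map f ≫ map g
  map₂_id {X Y : C} (f : A.Hom X Y) : map₂ (𝟙 f.hom) = 𝟙 (map f)
  map₂_comp {X Y : C} {f g h : A.Hom X Y} (η : f.hom ⟶ g.hom) (θ : g.hom ⟶ h.hom) :
    map₂ (f := f) (g := h) (η ≫ θ) = map₂ η ≫ map₂ θ
  map₂_whisker_left {X Y Z : C} (f : A.Hom X Y) {g h : A.Hom Y Z} (η : g.hom ⟶ h.hom) :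
    map₂ (f := f.comp g) (g := f.comp h) (f.hom ◁ η) =
      (mapComp f g).hom ≫ map f ◁ map₂ η ≫ (mapComp f h).inv
  map₂_whisker_right {X Y Z : C} {f g : A.Hom X Y} (η : f.hom ⟶ g.hom) (h : A.Hom Y Z) :
    map₂ (f := f.comp h) (g := g.comp h) (η ▷ h.hom) =
      (mapComp f h).hom ≫ map₂ η ▷ map h ≫ (mapComp g h).inv
  map₂_associator {X Y Z W : C} (f : A.Hom X Y) (g : A.Hom Y Z) (h : A.Hom Z W) :
    map₂ (f := (f.comp g).comp h) (g := f.comp (g.comp h)) (α_ f.hom g.hom h.hom).hom =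
      (mapComp (f.comp g) h).hom ≫ (mapComp f g).hom ▷ map h ≫
      (α_ (map f) (map g) (map h)).hom ≫ map f ◁ (mapComp g h).inv ≫
      (mapComp f (g.comp h)).inv
  map₂_left_unitor {X Y : C} (f : A.Hom X Y) :
    map₂ (f := (A.id X).comp f) (g := f) (λ_ f.hom).hom =
      (mapComp (A.id X) f).hom ≫ (mapId X).hom ▷ map f ≫ (λ_ (map f)).hom
  map₂_right_unitor {X Y : C} (f : A.Hom X Y) :
    map₂ (f := f.comp (A.id Y)) (g := f) (ρ_ f.hom).hom =
      (mapComp f (A.id Y)).hom ≫ map f ◁ (mapId Y).hom ≫ (ρ_ (map f)).hom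

/-- Restriction of a pseudofunctor to a smaller arrowy 2-subcategory. -/
abbrev PseudofunctorOn.restrict {A B : ArrowySubcategory C} {obj : C → D} (h : A ≤ B)
    (F : PseudofunctorOn B obj) : PseudofunctorOn A obj where
  map f := F.map (f.incl h)
  map₂ η := F.map₂ η
  mapId X := F.mapId X
  mapComp f g := F.mapComp (f.incl h) (g.incl h)
  map₂_id _ := F.map₂_id _
  map₂_comp {_ _ f g k} η θ :=
    F.map₂_comp (f := f.incl h) (g := g.incl h) (h := k.incl h) η θ
  map₂_whisker_left {_ _ _} f {g g'} η :=
    F.map₂_whisker_left (f.incl h) (g := g.incl h) (h := g'.incl h) η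
  map₂_whisker_right {_ _ _ f f'} η g :=
    F.map₂_whisker_right (f := f.incl h) (g := f'.incl h) η (g.incl h)
  map₂_associator f g k := F.map₂_associator (f.incl h) (g.incl h) (k.incl h)
  map₂_left_unitor f := F.map₂_left_unitor (f.incl h)
  map₂_right_unitor f := F.map₂_right_unitor (f.incl h)

/-- A pseudonatural transformation `F ⇒ F'` whose component at `X` is the given morphism `app X`.
The fields are those of `CategoryTheory.Pseudofunctor.StrongTrans`. -/
structure StrongTransOn {A : ArrowySubcategory C} {obj obj' : C → D}
    (F : PseudofunctorOn A obj) (F' : PseudofunctorOn A obj') (app : ∀ X, obj X ⟶ obj' X) where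
  /-- the naturality constraint -/
  naturality {X Y : C} (f : A.Hom X Y) : F.map f ≫ app Y ≅ app X ≫ F'.map f
  naturality_naturality {X Y : C} {f g : A.Hom X Y} (η : f.hom ⟶ g.hom) :
    F.map₂ η ▷ app Y ≫ (naturality g).hom = (naturality f).hom ≫ app X ◁ F'.map₂ η
  naturality_id (X : C) :
    (naturality (A.id X)).hom ≫ app X ◁ (F'.mapId X).hom =
      (F.mapId X).hom ▷ app X ≫ (λ_ (app X)).hom ≫ (ρ_ (app X)).inv
  naturality_comp {X Y Z : C} (f : A.Hom X Y) (g : A.Hom Y Z) :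
    (naturality (f.comp g)).hom ≫ app X ◁ (F'.mapComp f g).hom =
      (F.mapComp f g).hom ▷ app Z ≫ (α_ _ _ _).hom ≫ F.map f ◁ (naturality g).hom ≫
      (α_ _ _ _).inv ≫ (naturality f).hom ▷ F'.map g ≫ (α_ _ _ _).hom

namespace StrongTransOn

variable {A B : ArrowySubcategory C} {obj obj' obj'' : C → D}
  {F : PseudofunctorOn A obj} {F' : PseudofunctorOn A obj'} {F'' : PseudofunctorOn A obj''}
  {app : ∀ X, obj X ⟶ obj' X} {app' : ∀ X, obj' X ⟶ obj'' X}

theorem naturality_hom (t : StrongTransOn F F' app) {X Y : C} {f g : A.Hom X Y}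
    (η : f.hom ⟶ g.hom) {Z : D} (k : obj' Y ⟶ Z) :
    F.map₂ η ▷ app Y ▷ k ≫ (t.naturality g).hom ▷ k =
      (t.naturality f).hom ▷ k ≫ (app X ◁ F'.map₂ η) ▷ k := by
  rw [← comp_whiskerRight, t.naturality_naturality, comp_whiskerRight]

theorem naturality_id_hom (t : StrongTransOn F F' app) (X : C) :
    (t.naturality (A.id X)).hom =
      (F.mapId X).hom ▷ app X ≫ (λ_ (app X)).hom ≫ (ρ_ (app X)).inv ≫
        app X ◁ (F'.mapId X).inv := by
  simp [← cancel_mono (app X ◁ (F'.mapId X).hom), t.naturality_id]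

theorem naturality_comp_hom (t : StrongTransOn F F' app) {X Y Z : C} (f : A.Hom X Y)
    (g : A.Hom Y Z) :
    (t.naturality (f.comp g)).hom =
      (F.mapComp f g).hom ▷ app Z ≫ (α_ _ _ _).hom ≫ F.map f ◁ (t.naturality g).hom ≫
      (α_ _ _ _).inv ≫ (t.naturality f).hom ▷ F'.map g ≫ (α_ _ _ _).hom ≫
      app X ◁ (F'.mapComp f g).inv := by
  simp [← cancel_mono (app X ◁ (F'.mapComp f g).hom), t.naturality_comp]

variable (F) in
/-- The identity pseudonatural transformation. -/
@[reducible] def id : StrongTransOn F F (fun X => 𝟙 (obj X)) where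
  naturality f := ρ_ (F.map f) ≪≫ (λ_ (F.map f)).symm
  naturality_naturality _ := by simp
  naturality_id _ := by simp
  naturality_comp _ _ := by simp

/-- The composition of pseudonatural transformations. -/
@[reducible] def comp (t : StrongTransOn F F' app) (t' : StrongTransOn F' F'' app') :
    StrongTransOn F F'' (fun X => app X ≫ app' X) where
  naturality {X Y} f := (α_ _ _ _).symm ≪≫ whiskerRightIso (t.naturality f) (app' Y) ≪≫
    α_ _ _ _ ≪≫ whiskerLeftIso (app X) (t'.naturality f) ≪≫ (α_ _ _ _).symm
  naturality_naturality {X Y f g} η := by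
    have h := t.naturality_hom η (app' Y)
    have h' := congrArg (fun k => app X ◁ k) (t'.naturality_naturality η)
    simp only [whiskerLeft_comp] at h'
    simp
    rw [reassoc_of% h]
    simp [reassoc_of% h']
  naturality_id X := by
    simp [naturality_id_hom]
  naturality_comp {X Y Z} f g := by
    simp only [naturality_comp_hom, Iso.trans_hom, Iso.symm_hom, whiskerRightIso_hom,
      whiskerLeftIso_hom]
    calc
      _ = 𝟙 _ ⊗≫ (F.mapComp f g).hom ▷ app Z ▷ app' Z ⊗≫
            F.map f ◁ (t.naturality g).hom ▷ app' Z ⊗≫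
            ((t.naturality f).hom ▷ (F'.map g ≫ app' Z) ≫
              (app X ≫ F'.map f) ◁ (t'.naturality g).hom) ⊗≫
            app X ◁ (t'.naturality f).hom ▷ F''.map g ⊗≫ 𝟙 _ := by
        simp [bicategoricalComp]
      _ = _ := by
        rw [← whisker_exchange]
        simp [bicategoricalComp]

/-- Restriction of a pseudonatural transformation to a smaller arrowy 2-subcategory. -/
@[reducible] def restrict {F : PseudofunctorOn B obj} {F' : PseudofunctorOn B obj'} (h : A ≤ B)
    (t : StrongTransOn F F' app) : StrongTransOn (F.restrict h) (F'.restrict h) app where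
  naturality f := t.naturality (f.incl h)
  naturality_naturality {_ _ f g} η :=
    t.naturality_naturality (f := f.incl h) (g := g.incl h) η
  naturality_id X := t.naturality_id X
  naturality_comp f g := t.naturality_comp (f.incl h) (g.incl h)

end StrongTransOn

end PrescribedObj

/-! ### 2-commutative cubes -/

/-- 2-commutativity of a cube with vertices `X Y Z W` (bottom), `X' Y' Z' W'` (top), edges
`a, b, a', b'` (first direction), `p, q, p', q'` (second direction), `x, y, z, w` (third
direction), and 2-cells on the right (`I`), left (`I'`), front (`J`), back (`J'`), bottom (`K`)
and top (`K'`) faces: the two composite 2-cells from `a q x` to `w p' b'` coincide. -/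
def CubeCommutes {C : Type u₁} [Bicategory.{w₁, v₁} C] {X Y Z W X' Y' Z' W' : C}
    {b : X ⟶ Y} {q : X ⟶ Z} {p : Y ⟶ W} {a : Z ⟶ W}
    {b' : X' ⟶ Y'} {q' : X' ⟶ Z'} {p' : Y' ⟶ W'} {a' : Z' ⟶ W'}
    {x : X' ⟶ X} {y : Y' ⟶ Y} {z : Z' ⟶ Z} {w : W' ⟶ W}
    (I : y ≫ p ⟶ p' ≫ w) (I' : x ≫ q ⟶ q' ≫ z)
    (J : z ≫ a ⟶ a' ≫ w) (J' : x ≫ b ⟶ b' ≫ y)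
    (K : q ≫ a ⟶ b ≫ p) (K' : q' ≫ a' ⟶ b' ≫ p') : Prop :=
  x ◁ K ≫ (α_ x b p).inv ≫ J' ▷ p ≫ (α_ b' y p).hom ≫ b' ◁ I =
    (α_ x q a).inv ≫ I' ▷ a ≫ (α_ q' z a).hom ≫ q' ◁ J ≫ (α_ q' a' w).inv ≫
      K' ▷ w ≫ (α_ b' p' w).hom

/-! ### Gluing data -/

section GluingData

variable {C : Type u₁} [Bicategory.{w₁, v₁} C] {ι : Type t}

/-- An object of the 2-category of gluing data from `C` to `D` relative to a family
`A i` of arrowy 2-subcategories of `C`: pseudofunctors `F i : A i ⥤ᵖ D` with the same object map,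
and, for all `i`, `j` and each square in `C`
```
  X --b--> Y
  |        |
  q   α    p       α : a q ⇒ p b
  v        v
  Z --a--> W
```
with `a`, `b` in `A i` and `p`, `q` in `A j`, an invertible 2-cell
`F i (a) F j (q) ⇒ F j (p) F i (b)`, subject to compatibilities. -/
structure GluingData (A : ι → ArrowySubcategory C) (D : Type u₂) [Bicategory.{w₂, v₂} D] where
  /-- the common map on objects -/
  obj : C → D
  /-- the pseudofunctors -/
  F (i : ι) : PseudofunctorOn (A i) obj
  /-- the gluing 2-cells -/
  G (i j : ι) {X Y Z W : C} (b : (A i).Hom X Y) (q : (A j).Hom X Z) (p : (A j).Hom Y W)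
    (a : (A i).Hom Z W) (α : q.hom ≫ a.hom ⟶ b.hom ≫ p.hom) :
    (F j).map q ≫ (F i).map a ≅ (F i).map b ≫ (F j).map p
  /-- compatibility with the 2-cells of `A i` -/
  G_two_cell (i j : ι) {X Y : C} {a b : (A i).Hom X Y} (η : a.hom ⟶ b.hom) :
    ((F j).mapId X).hom ▷ (F i).map a ≫ (λ_ ((F i).map a)).hom ≫ (F i).map₂ η =
      (G i j b ((A j).id X) ((A j).id Y) a ((λ_ a.hom).hom ≫ η ≫ (ρ_ b.hom).inv)).hom ≫
        (F i).map b ◁ ((F j).mapId Y).hom ≫ (ρ_ ((F i).map b)).hom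
  /-- description of `G i i` -/
  G_self (i : ι) {X Y Z W : C} (b : (A i).Hom X Y) (q : (A i).Hom X Z) (p : (A i).Hom Y W)
    (a : (A i).Hom Z W) (α : q.hom ≫ a.hom ⟶ b.hom ≫ p.hom) :
    ((F i).mapComp q a).hom ≫ (G i i b q p a α).hom = (F i).map₂ (f := q.comp a) (g := b.comp p) α ≫ ((F i).mapComp b p).hom
  /-- compatibility with 2-commutative cubes -/
  G_cube (i j k : ι) {X Y Z W X' Y' Z' W' : C}
    (b : (A i).Hom X Y) (q : (A j).Hom X Z) (p : (A j).Hom Y W) (a : (A i).Hom Z W)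
    (b' : (A i).Hom X' Y') (q' : (A j).Hom X' Z') (p' : (A j).Hom Y' W') (a' : (A i).Hom Z' W')
    (x : (A k).Hom X' X) (y : (A k).Hom Y' Y) (z : (A k).Hom Z' Z) (w : (A k).Hom W' W)
    (I : y.hom ≫ p.hom ⟶ p'.hom ≫ w.hom) (I' : x.hom ≫ q.hom ⟶ q'.hom ≫ z.hom)
    (J : z.hom ≫ a.hom ⟶ a'.hom ≫ w.hom) (J' : x.hom ≫ b.hom ⟶ b'.hom ≫ y.hom)
    (K : q.hom ≫ a.hom ⟶ b.hom ≫ p.hom) (K' : q'.hom ≫ a'.hom ⟶ b'.hom ≫ p'.hom) :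
    CubeCommutes I I' J J' K K' →
      CubeCommutes (G j k p' y w p I).hom (G j k q' x z q I').hom (G i k a' z w a J).hom
        (G i k b' x y b J').hom (G i j b q p a K).hom (G i j b' q' p' a' K').hom

variable {A : ι → ArrowySubcategory C} {D : Type u₂} [Bicategory.{w₂, v₂} D]

namespace GluingData

/-- A morphism of gluing data: pseudonatural transformations `F i ⇒ F' i` with the same
components, compatible with the gluing 2-cells. The compatibility is the commutativity of the
hexagon with vertices `α₀(W) Fᵢ(a) Fⱼ(q)`, `F'ᵢ(a) α₀(Z) Fⱼ(q)`, `F'ᵢ(a) F'ⱼ(q) α₀(X)`,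
`α₀(W) Fⱼ(p) Fᵢ(b)`, `F'ⱼ(p) α₀(Y) Fᵢ(b)`, `F'ⱼ(p) F'ᵢ(b) α₀(X)`. -/
structure Hom (S T : GluingData A D) where
  /-- the common components -/
  app (X : C) : S.obj X ⟶ T.obj X
  /-- the pseudonatural transformations -/
  trans (i : ι) : StrongTransOn (S.F i) (T.F i) app
  hexagon (i j : ι) {X Y Z W : C} (b : (A i).Hom X Y) (q : (A j).Hom X Z) (p : (A j).Hom Y W)
    (a : (A i).Hom Z W) (α : q.hom ≫ a.hom ⟶ b.hom ≫ p.hom) :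
    (α_ _ _ _).hom ≫ (S.F j).map q ◁ ((trans i).naturality a).hom ≫ (α_ _ _ _).inv ≫
        ((trans j).naturality q).hom ▷ (T.F i).map a ≫ (α_ _ _ _).hom ≫
        app X ◁ (T.G i j b q p a α).hom =
      (S.G i j b q p a α).hom ▷ app W ≫ (α_ _ _ _).hom ≫
        (S.F i).map b ◁ ((trans j).naturality p).hom ≫ (α_ _ _ _).inv ≫
        ((trans i).naturality b).hom ▷ (T.F j).map p ≫ (α_ _ _ _).hom

/-- A 2-cell `σ ⇒ τ` between morphisms of gluing data: a family of 2-cells `σ.app X ⇒ τ.app X`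
which is, for each `i`, a modification between the pseudonatural transformations
`σ.trans i` and `τ.trans i`. -/
@[ext]
structure Hom₂ {S T : GluingData A D} (σ τ : Hom S T) where
  /-- the common components -/
  app (X : C) : σ.app X ⟶ τ.app X
  naturality (i : ι) {X Y : C} (f : (A i).Hom X Y) :
    (S.F i).map f ◁ app Y ≫ ((τ.trans i).naturality f).hom =
      ((σ.trans i).naturality f).hom ≫ app X ▷ (T.F i).map f

instance (S T : GluingData A D) : Category (Hom S T) where
  Hom σ τ := Hom₂ σ τ
  id σ :=
    { app := fun X => 𝟙 (σ.app X)
      naturality := by intros; simp }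
  comp Γ Λ :=
    { app := fun X => Γ.app X ≫ Λ.app X
      naturality := fun i X Y f => by
        rw [whiskerLeft_comp, Category.assoc, Λ.naturality, ← Category.assoc, Γ.naturality,
          Category.assoc, comp_whiskerRight] }
  id_comp _ := Hom₂.ext (funext fun _ => Category.id_comp _)
  comp_id _ := Hom₂.ext (funext fun _ => Category.comp_id _)
  assoc _ _ _ := Hom₂.ext (funext fun _ => Category.assoc _ _ _)

/-- An invertible 2-cell from a family of invertible 2-cells. -/
def Hom.isoMk {S T : GluingData A D} {σ τ : Hom S T} (e : ∀ X, σ.app X ≅ τ.app X)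
    (h : ∀ (i : ι) {X Y : C} (f : (A i).Hom X Y),
      (S.F i).map f ◁ (e Y).hom ≫ ((τ.trans i).naturality f).hom =
        ((σ.trans i).naturality f).hom ≫ (e X).hom ▷ (T.F i).map f) : σ ≅ τ where
  hom := { app := fun X => (e X).hom, naturality := h }
  inv :=
    { app := fun X => (e X).inv
      naturality := fun i X Y f => by
        simpa using _ ◁ (e Y).inv ≫= (h i f).symm =≫ (e X).inv ▷ _ }
  hom_inv_id := Hom₂.ext (funext fun X => (e X).hom_inv_id)
  inv_hom_id := Hom₂.ext (funext fun X => (e X).inv_hom_id)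

/-- The identity morphism. -/
@[reducible] def Hom.id (S : GluingData A D) : Hom S S where
  app X := 𝟙 (S.obj X)
  trans i := StrongTransOn.id (S.F i)
  hexagon i j X Y Z W b q p a α := by
    simp

/-- The composition of morphisms. -/
@[reducible] def Hom.comp {S T U : GluingData A D} (σ : Hom S T) (τ : Hom T U) : Hom S U where
  app X := σ.app X ≫ τ.app X
  trans i := (σ.trans i).comp (τ.trans i)
  hexagon i j X Y Z W b q p a α := by
    have h1 := σ.hexagon i j b q p a α
    have h2 := τ.hexagon i j b q p a α
    simp only [Iso.trans_hom, Iso.symm_hom, whiskerRightIso_hom,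
      whiskerLeftIso_hom]
    calc
      _ = 𝟙 _ ⊗≫ (S.F j).map q ◁ ((σ.trans i).naturality a).hom ▷ τ.app W ⊗≫
            (((S.F j).map q ≫ σ.app Z) ◁ ((τ.trans i).naturality a).hom ≫
              ((σ.trans j).naturality q).hom ▷ (τ.app Z ≫ (U.F i).map a)) ⊗≫
            σ.app X ◁ ((τ.trans j).naturality q).hom ▷ (U.F i).map a ⊗≫
            σ.app X ◁ τ.app X ◁ (U.G i j b q p a α).hom ⊗≫ 𝟙 _ := by
        bicategory
      _ = 𝟙 _ ⊗≫ ((α_ _ _ _).hom ≫ (S.F j).map q ◁ ((σ.trans i).naturality a).hom ≫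
              (α_ _ _ _).inv ≫ ((σ.trans j).naturality q).hom ▷ (T.F i).map a) ▷ τ.app W ⊗≫
            σ.app X ◁ ((α_ _ _ _).hom ≫ (T.F j).map q ◁ ((τ.trans i).naturality a).hom ≫
              (α_ _ _ _).inv ≫ ((τ.trans j).naturality q).hom ▷ (U.F i).map a ≫
              (α_ _ _ _).hom ≫ τ.app X ◁ (U.G i j b q p a α).hom) ⊗≫ 𝟙 _ := by
        rw [whisker_exchange]
        bicategory
      _ = 𝟙 _ ⊗≫ ((α_ _ _ _).hom ≫ (S.F j).map q ◁ ((σ.trans i).naturality a).hom ≫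
              (α_ _ _ _).inv ≫ ((σ.trans j).naturality q).hom ▷ (T.F i).map a ≫
              (α_ _ _ _).hom ≫ σ.app X ◁ (T.G i j b q p a α).hom) ▷ τ.app W ⊗≫
            σ.app X ◁ (T.F i).map b ◁ ((τ.trans j).naturality p).hom ⊗≫
            σ.app X ◁ ((τ.trans i).naturality b).hom ▷ (U.F j).map p ⊗≫ 𝟙 _ := by
        rw [h2]
        bicategory
      _ = 𝟙 _ ⊗≫ (S.G i j b q p a α).hom ▷ σ.app W ▷ τ.app W ⊗≫
            (S.F i).map b ◁ ((σ.trans j).naturality p).hom ▷ τ.app W ⊗≫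
            (((σ.trans i).naturality b).hom ▷ ((T.F j).map p ≫ τ.app W) ≫
              (σ.app X ≫ (T.F i).map b) ◁ ((τ.trans j).naturality p).hom) ⊗≫
            σ.app X ◁ ((τ.trans i).naturality b).hom ▷ (U.F j).map p ⊗≫ 𝟙 _ := by
        rw [h1]
        bicategory
      _ = _ := by
        rw [← whisker_exchange]
        bicategory

/-- Left whiskering, componentwise. -/
@[reducible] def Hom₂.whiskerLeft {S T U : GluingData A D} (σ : Hom S T) {τ τ' : Hom T U}
    (Γ : Hom₂ τ τ') : Hom₂ (σ.comp τ) (σ.comp τ') where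
  app X := σ.app X ◁ Γ.app X
  naturality i X Y f := by
    have h := congrArg (fun k => σ.app X ◁ k) (Γ.naturality i f)
    simp only [whiskerLeft_comp] at h
    simp only [Iso.trans_hom, Iso.symm_hom, whiskerRightIso_hom, whiskerLeftIso_hom]
    rw [associator_inv_naturality_right_assoc, whisker_exchange_assoc]
    simp [reassoc_of% h]

/-- Right whiskering, componentwise. -/
@[reducible] def Hom₂.whiskerRight {S T U : GluingData A D} {σ σ' : Hom S T} (Γ : Hom₂ σ σ')
    (τ : Hom T U) : Hom₂ (σ.comp τ) (σ'.comp τ) where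
  app X := Γ.app X ▷ τ.app X
  naturality i X Y f := by
    have h := congrArg (fun k => k ▷ τ.app Y) (Γ.naturality i f)
    simp only [comp_whiskerRight] at h
    simp only [Iso.trans_hom, Iso.symm_hom, whiskerRightIso_hom, whiskerLeftIso_hom,
      Category.assoc]
    rw [← associator_inv_naturality_left, whisker_exchange_assoc,
      associator_inv_naturality_middle_assoc, reassoc_of% h]
    simp

/-- The associator, componentwise. -/
def Hom.associator {S T U V : GluingData A D} (σ : Hom S T) (τ : Hom T U) (υ : Hom U V) :
    (σ.comp τ).comp υ ≅ σ.comp (τ.comp υ) :=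
  Hom.isoMk (fun X => α_ (σ.app X) (τ.app X) (υ.app X)) fun i X Y f => by simp

/-- The left unitor, componentwise. -/
def Hom.leftUnitor {S T : GluingData A D} (σ : Hom S T) : (Hom.id S).comp σ ≅ σ :=
  Hom.isoMk (fun X => λ_ (σ.app X)) fun i X Y f => by simp

/-- The right unitor, componentwise. -/
def Hom.rightUnitor {S T : GluingData A D} (σ : Hom S T) : σ.comp (Hom.id T) ≅ σ :=
  Hom.isoMk (fun X => ρ_ (σ.app X)) fun i X Y f => by simp

/-- The 2-category of gluing data. Compositions and whiskerings are those of `D`, componentwise. -/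
instance : Bicategory.{max u₁ w₂, max t u₁ v₁ w₂ v₂} (GluingData A D) where
  Hom S T := Hom S T
  id S := Hom.id S
  comp σ τ := Hom.comp σ τ
  homCategory S T := inferInstanceAs (Category (Hom S T))
  whiskerLeft σ _ _ Γ := Hom₂.whiskerLeft σ Γ
  whiskerRight Γ τ := Hom₂.whiskerRight Γ τ
  associator σ τ υ := Hom.associator σ τ υ
  leftUnitor σ := Hom.leftUnitor σ
  rightUnitor σ := Hom.rightUnitor σ
  whiskerLeft_id _ _ := Hom₂.ext (funext fun _ => whiskerLeft_id _ _)
  whiskerLeft_comp _ _ _ _ _ _ := Hom₂.ext (funext fun _ => whiskerLeft_comp _ _ _)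
  id_whiskerLeft _ := Hom₂.ext (funext fun _ => id_whiskerLeft _)
  comp_whiskerLeft _ _ _ _ _ := Hom₂.ext (funext fun _ => comp_whiskerLeft _ _ _)
  id_whiskerRight _ _ := Hom₂.ext (funext fun _ => id_whiskerRight _ _)
  comp_whiskerRight _ _ _ := Hom₂.ext (funext fun _ => comp_whiskerRight _ _ _)
  whiskerRight_id _ := Hom₂.ext (funext fun _ => whiskerRight_id _)
  whiskerRight_comp _ _ _ := Hom₂.ext (funext fun _ => whiskerRight_comp _ _ _)
  whisker_assoc _ _ _ _ _ := Hom₂.ext (funext fun _ => whisker_assoc _ _ _)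
  whisker_exchange _ _ := Hom₂.ext (funext fun _ => whisker_exchange _ _)
  pentagon _ _ _ _ := Hom₂.ext (funext fun _ => pentagon _ _ _ _)
  triangle _ _ := Hom₂.ext (funext fun _ => triangle _ _)

/-- Two morphisms of gluing data with the same components are equal if the identity 2-cells form
a 2-cell between them. -/
theorem Hom.ext_of_eqToHom {S T : GluingData A D} {σ τ : Hom S T} (h : ∀ X, σ.app X = τ.app X)
    (Γ : Hom₂ σ τ) (hΓ : ∀ X, Γ.app X = eqToHom (h X)) : σ = τ := by
  obtain ⟨s, t, _⟩ := σ
  obtain ⟨s', t', _⟩ := τ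
  obtain rfl : s = s' := funext h
  obtain rfl : t = t' := by
    funext i
    have H : @(t i).naturality = @(t' i).naturality := by
      funext X Y f
      have := Γ.naturality i f
      rw [hΓ, hΓ] at this
      exact Iso.ext (by simpa using this.symm)
    cases hi : t i
    cases hi' : t' i
    rw [hi, hi'] at H
    cases H
    rfl
  rfl

/-- An invertible 2-cell whose components are given by equalities is given by an equality. -/
theorem eq_eqToIso {S T : GluingData A D} {σ τ : S ⟶ T} (e : σ ≅ τ) (h : σ = τ)
    (he : ∀ X, Hom₂.app e.hom X = eqToHom (by rw [h])) : e = eqToIso h := by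
  subst h
  exact Iso.ext (Hom₂.ext (funext fun X => he X))

instance [Strict D] : Strict (GluingData A D) where
  id_comp σ := Hom.ext_of_eqToHom (fun X => Strict.id_comp (Hom.app σ X)) (λ_ σ).hom
    fun X => congrArg Iso.hom (Strict.leftUnitor_eqToIso (Hom.app σ X))
  comp_id σ := Hom.ext_of_eqToHom (fun X => Strict.comp_id (Hom.app σ X)) (ρ_ σ).hom
    fun X => congrArg Iso.hom (Strict.rightUnitor_eqToIso (Hom.app σ X))
  assoc σ τ υ := Hom.ext_of_eqToHom
    (fun X => Strict.assoc (Hom.app σ X) (Hom.app τ X) (Hom.app υ X)) (α_ σ τ υ).hom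
    fun X => congrArg Iso.hom
      (Strict.associator_eqToIso (Hom.app σ X) (Hom.app τ X) (Hom.app υ X))
  leftUnitor_eqToIso σ := eq_eqToIso (λ_ σ) _ fun X =>
    congrArg Iso.hom (Strict.leftUnitor_eqToIso (Hom.app σ X))
  rightUnitor_eqToIso σ := eq_eqToIso (ρ_ σ) _ fun X =>
    congrArg Iso.hom (Strict.rightUnitor_eqToIso (Hom.app σ X))
  associator_eqToIso σ τ υ := eq_eqToIso (α_ σ τ υ) _ fun X =>
    congrArg Iso.hom (Strict.associator_eqToIso (Hom.app σ X) (Hom.app τ X) (Hom.app υ X))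

variable [Strict D]

variable (A D) in
/-- The forgetful 2-functor from gluing data to `D^{Ob C}`. -/
def forget : StrictPseudofunctor (GluingData A D) (Pow D C) := StrictPseudofunctor.mk''
  { obj := fun S => ⟨S.obj⟩
    map := fun σ => ⟨fun X => Hom.app σ X⟩
    map₂ := fun Γ => ⟨fun X => Hom₂.app Γ X⟩
    map₂_id := fun _ => rfl
    map₂_comp := fun _ _ => rfl
    map_id := fun _ => rfl
    map_comp := fun _ _ => rfl
    map₂_whisker_left := fun _ _ _ _ => by
      rw [eqToHom_refl, eqToHom_refl, Category.id_comp, Category.comp_id]; rfl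
    map₂_whisker_right := fun _ _ => by
      rw [eqToHom_refl, eqToHom_refl, Category.id_comp, Category.comp_id]; rfl }

section Reindex

variable {κ : Type t'} {B : κ → ArrowySubcategory C} (φ : ι → κ) (h : ∀ i, A i ≤ B (φ i))

/-- Reindexing of gluing data: `((F k), (G k l)) ↦ ((F (φ i)), (G (φ i) (φ j)))`, where
`F (φ i)` is restricted to `A i`. -/
@[reducible] def reindexObj (S : GluingData B D) : GluingData A D where
  obj := S.obj
  F i := (S.F (φ i)).restrict (h i)
  G i j _ _ _ _ b q p a α :=
    S.G (φ i) (φ j) (b.incl (h i)) (q.incl (h j)) (p.incl (h j)) (a.incl (h i)) α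
  G_two_cell i j _ _ a b η :=
    S.G_two_cell (φ i) (φ j) (a := a.incl (h i)) (b := b.incl (h i)) η
  G_self i _ _ _ _ b q p a α :=
    S.G_self (φ i) (b.incl (h i)) (q.incl (h i)) (p.incl (h i)) (a.incl (h i)) α
  G_cube i j k _ _ _ _ _ _ _ _ b q p a b' q' p' a' x y z w I I' J J' K K' :=
    S.G_cube (φ i) (φ j) (φ k)
      (b.incl (h i)) (q.incl (h j)) (p.incl (h j)) (a.incl (h i))
      (b'.incl (h i)) (q'.incl (h j)) (p'.incl (h j)) (a'.incl (h i))
      (x.incl (h k)) (y.incl (h k)) (z.incl (h k)) (w.incl (h k)) I I' J J' K K'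

/-- Reindexing of morphisms of gluing data: `(α k) ↦ (α (φ i))`. -/
@[reducible] def reindexHom {S T : GluingData B D} (σ : Hom S T) :
    Hom (reindexObj φ h S) (reindexObj φ h T) where
  app := σ.app
  trans i := (σ.trans (φ i)).restrict (h i)
  hexagon i j _ _ _ _ b q p a α :=
    σ.hexagon (φ i) (φ j) (b.incl (h i)) (q.incl (h j)) (p.incl (h j)) (a.incl (h i)) α

/-- Reindexing of 2-cells of gluing data: `(Ξ k) ↦ (Ξ (φ i))`. -/
@[reducible] def reindexHom₂ {S T : GluingData B D} {σ τ : Hom S T} (Γ : Hom₂ σ τ) :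
    Hom₂ (reindexHom φ h σ) (reindexHom φ h τ) where
  app := Γ.app
  naturality i _ _ f := Γ.naturality (φ i) (f.incl (h i))

/-- The reindexing 2-functor from gluing data relative to `B` to gluing data relative to `A`. -/
def reindex : StrictPseudofunctor (GluingData B D) (GluingData A D) := StrictPseudofunctor.mk''
  { obj := fun S => reindexObj φ h S
    map := fun σ => reindexHom φ h σ
    map₂ := fun Γ => reindexHom₂ φ h Γ
    map₂_id := fun _ => rfl
    map₂_comp := fun _ _ => rfl
    map_id := fun _ => rfl
    map_comp := fun _ _ => rfl
    map₂_whisker_left := fun _ _ _ _ => by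
      rw [eqToHom_refl, eqToHom_refl, Category.id_comp, Category.comp_id]; rfl
    map₂_whisker_right := fun _ _ => by
      rw [eqToHom_refl, eqToHom_refl, Category.id_comp, Category.comp_id]; rfl }

variable (D) in
/-- The `D^{Ob C}`-functor `Q^φ` from gluing data relative to `B` to gluing data relative
to `A`, for a map `φ` of index sets with `A i ⊆ B (φ i)`. -/
def Q : OverFunctor (forget B D) (forget A D) where
  functor := reindex φ h
  comm := strictPseudofunctor_ext rfl

end Reindex

end GluingData

end GluingData

end Gluing

/-! ### Values of the gluing 2-cells on unit squares. -/

namespace Gluing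

namespace GluingData

variable {C : Type u₁} [Bicategory.{w₁, v₁} C] {ι : Type t}
  {A : ι → ArrowySubcategory C} {D : Type u₂} [Bicategory.{w₂, v₂} D] (S : GluingData A D)

/-! Both composites of `Q^φ` and `Q^φ'` reindex a family along a self-map `ψ` of its own index set
with `A i ≤ A (ψ i)`: `φ' ∘ φ` for the family `A`, and `φ ∘ φ'` for `A ∘ φ'`. It therefore suffices
to show that a gluing datum is naturally equivalent to its reindexing along any such `ψ`, by 1-cells
with identity components.

When `A i ≤ A j`, the datum itself contains an isomorphism `F j (f) ≅ F i (f)` for `f` in `A i`: up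
to unit constraints it is `G i j` on the square with `f` on one side as a morphism of `A i`, `f` on
another as a morphism of `A j`, and two identities (`comparison`). The core of the argument is that
these isomorphisms carry `G` to `G` in each index separately (`comparison_G`, `G_comparison`). Each
of these is one instance of axiom (D): a cube with comparison squares on two opposite faces, the
given square on two of the other faces, and unit squares on the remaining two. Axiom (A) evaluates
the unit squares whose sides in the second index are identities. The transposed ones are covered by
no axiom and are computed in `G_id_right`, again from a cube.

Specialising these two rules to squares on which (A) or (O) gives the value of `G` shows that the
comparison respects 2-cells, units and composition. It is thus an invertible pseudonatural
transformation with identity components, hence a morphism of gluing data, and the hexagon of a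
morphism at a comparison square makes it natural in the datum. All components, and all 2-cells
involved, are unitors or identities of `D`. Since `D` is strict they project to identities in `D^{Ob
C}`. -/

theorem G_of_id {i j : ι} {X Y : C} {a b : (A i).Hom X Y} (η : a.hom ⟶ b.hom)
    (α : (𝟙 X) ≫ a.hom ⟶ b.hom ≫ 𝟙 Y) (h : α = (λ_ a.hom).hom ≫ η ≫ (ρ_ b.hom).inv) :
    (S.G i j b ((A j).id X) ((A j).id Y) a α).hom =
      ((S.F j).mapId X).hom ▷ (S.F i).map a ≫ (λ_ ((S.F i).map a)).hom ≫ (S.F i).map₂ η ≫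
        (ρ_ ((S.F i).map b)).inv ≫ (S.F i).map b ◁ ((S.F j).mapId Y).inv := by
  subst h
  have := S.G_two_cell i j η
  simp [reassoc_of% this]

/-- The gluing 2-cell of an identity square whose sides in `A j` are identities is canonical. -/
theorem G_of_id_id {i j : ι} {X Y : C} (a : (A i).Hom X Y)
    (α : (𝟙 X) ≫ a.hom ⟶ a.hom ≫ 𝟙 Y) (h : α = (λ_ a.hom).hom ≫ (ρ_ a.hom).inv) :
    (S.G i j a ((A j).id X) ((A j).id Y) a α).hom =
      ((S.F j).mapId X).hom ▷ (S.F i).map a ≫ (λ_ ((S.F i).map a)).hom ≫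
        (ρ_ ((S.F i).map a)).inv ≫ (S.F i).map a ◁ ((S.F j).mapId Y).inv := by
  simpa [(S.F i).map₂_id] using S.G_of_id (i := i) (j := j) (𝟙 a.hom) α (by simpa using h)

theorem G_self_id {i : ι} {X Y Z : C} (f : (A i).Hom X Y) (g : (A i).Hom Y Z) :
    (S.G i i f f g g (𝟙 _)).hom = 𝟙 _ := by
  have := S.G_self i f f g g (𝟙 _)
  rw [← cancel_epi ((S.F i).mapComp f g).hom, this, (S.F i).map₂_id (f.comp g)]
  simp

theorem whiskerRight_cancel {x y : D} {f g : x ⟶ y} {r : y ⟶ y} (d : r ≅ 𝟙 y) {η θ : f ⟶ g}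
    (h : η ▷ r = θ ▷ r) : η = θ := by
  have h' : η ▷ 𝟙 y = θ ▷ 𝟙 y := by
    rw [← cancel_epi (f ◁ d.hom), whisker_exchange, whisker_exchange, h]
  simpa using h'

/-- Conjugation by `e` and `d` reduces both exchanges to unitors of `𝟙 x`, where the left and right
unitors agree. This makes the bottom and right faces cancel in the cube behind `G_id_right`. -/
theorem swap_unit_swap {x : D} {r s : x ⟶ x} (e : s ≅ 𝟙 x) (d : r ≅ 𝟙 x) :
    (e.hom ▷ r ≫ (λ_ r).hom ≫ (ρ_ r).inv ≫ r ◁ e.inv) ≫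
      (d.hom ▷ s ≫ (λ_ s).hom ≫ (ρ_ s).inv ≫ s ◁ d.inv) = 𝟙 _ := by
  have h : e.hom ▷ r = s ◁ d.hom ≫ e.hom ▷ 𝟙 x ≫ 𝟙 x ◁ d.inv := by
    rw [← whisker_exchange]; simp [← whiskerLeft_comp_assoc]
  simp only [Category.assoc]
  rw [whisker_exchange_assoc, h]
  simp [unitors_equal, ← whiskerLeft_comp]

/-- With trivial front and back faces and mutually inverse bottom and right faces, the cube says
that `u` followed by the top face is the identity after whiskering with `r`. As `r` is isomorphic to
an identity, `u` is the inverse of the top face. -/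
theorem unit_swap_of_cube {x y : D} {g : x ⟶ y} {s : y ⟶ y} {s' : x ⟶ x} {r : y ⟶ y} (e : s ≅ 𝟙 y)
    (e' : s' ≅ 𝟙 x) (d : r ≅ 𝟙 y) (u : g ≫ s ⟶ s' ≫ g)
    (h : CubeCommutes (b := r) (q := s) (p := s) (a := r) (b' := g) (q' := s') (p' := s) (a' := g)
      (x := g) (y := r) (z := g) (w := r)
      (d.hom ▷ s ≫ (λ_ s).hom ≫ (ρ_ s).inv ≫ s ◁ d.inv) u (𝟙 _) (𝟙 _)
      (e.hom ▷ r ≫ (λ_ r).hom ≫ (ρ_ r).inv ≫ r ◁ e.inv)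
      (e'.hom ▷ g ≫ (λ_ g).hom ≫ (ρ_ g).inv ≫ g ◁ e.inv)) :
    u = g ◁ e.hom ≫ (ρ_ g).hom ≫ (λ_ g).inv ≫ e'.inv ▷ g := by
  have hu : u ≫ (e'.hom ▷ g ≫ (λ_ g).hom ≫ (ρ_ g).inv ≫ g ◁ e.inv) = 𝟙 _ := by
    apply whiskerRight_cancel d
    have hs := congrArg (fun k => g ◁ k) (swap_unit_swap e d)
    simp only [whiskerLeft_comp, Category.assoc, whiskerLeft_id] at hs
    simp only [CubeCommutes, id_whiskerRight, Category.id_comp, whiskerLeft_comp, Category.assoc,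
      Iso.inv_hom_id_assoc, hs, whiskerLeft_id, Iso.hom_inv_id_assoc] at h
    rw [comp_whiskerRight, ← cancel_mono (α_ g s r).hom, ← cancel_epi (α_ g s r).inv]
    simpa using h.symm
  rw [← cancel_mono (e'.hom ▷ g ≫ (λ_ g).hom ≫ (ρ_ g).inv ≫ g ◁ e.inv), hu]
  simp

/-- The gluing 2-cell of an identity square whose sides in `A i` are identities is canonical. This is
not one of the axioms: it comes from a cube with directions `j`, `i`, `j`. -/
theorem G_id_right {i j : ι} {Y W : C} (f : (A j).Hom Y W) :
    (S.G i j ((A i).id Y) f f ((A i).id W) ((ρ_ _).hom ≫ (λ_ _).inv)).hom =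
      (S.F j).map f ◁ ((S.F i).mapId W).hom ≫ (ρ_ _).hom ≫ (λ_ _).inv ≫
        ((S.F i).mapId Y).inv ▷ (S.F j).map f := by
  -- The unknown 2-cell sits on the left face. The top is its transpose, with indices `j`, `i`,
  -- which axiom (A) evaluates.
  have h := S.G_cube j i j ((A j).id W) ((A i).id W) ((A i).id W) ((A j).id W)
    f ((A i).id Y) ((A i).id W) f f ((A j).id W) f ((A j).id W)
    ((λ_ _).hom ≫ (ρ_ _).inv) ((ρ_ _).hom ≫ (λ_ _).inv) (𝟙 _) (𝟙 _)
    ((λ_ _).hom ≫ (ρ_ _).inv) ((λ_ _).hom ≫ (ρ_ _).inv) (by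
      unfold CubeCommutes
      dsimp
      bicategory)
  -- Axiom (A) gives the right, bottom and top faces; the front and back are identity squares inside
  -- `A j`, trivial by axiom (O).
  erw [S.G_of_id_id _ _ rfl, S.G_of_id_id _ _ rfl, S.G_of_id_id _ _ rfl, S.G_self_id] at h
  exact unit_swap_of_cube _ _ _ _ h

end GluingData

end Gluing

/-! ### The comparison `F j (f) ≅ F i (f)` and its exchange with `G`. -/

namespace Gluing

namespace GluingData

variable {C : Type u₁} [Bicategory.{w₁, v₁} C] {ι : Type t}
  {A : ι → ArrowySubcategory C} {D : Type u₂} [Bicategory.{w₂, v₂} D] (S : GluingData A D)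

/-- The comparison isomorphism `F j (f) ≅ F i (f)` for `f` in `A i ⊆ A j`, given by the gluing
2-cell of the square with sides `f`, `f` and two identities. -/
def comparison {i j : ι} (h : A i ≤ A j) {X Y : C} (f : (A i).Hom X Y) :
    (S.F j).map (f.incl h) ≅ (S.F i).map f :=
  (ρ_ _).symm ≪≫ whiskerLeftIso _ ((S.F i).mapId Y).symm ≪≫
    S.G i j f (f.incl h) ((A j).id Y) ((A i).id Y) (𝟙 _) ≪≫
    whiskerLeftIso _ ((S.F j).mapId Y) ≪≫ ρ_ _

theorem G_eq_comparison {i j : ι} (h : A i ≤ A j) {X Y : C} (f : (A i).Hom X Y) :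
    (S.G i j f (f.incl h) ((A j).id Y) ((A i).id Y) (𝟙 _)).hom =
      (S.F j).map (f.incl h) ◁ ((S.F i).mapId Y).hom ≫ (ρ_ _).hom ≫ (S.comparison h f).hom ≫
        (ρ_ _).inv ≫ (S.F i).map f ◁ ((S.F j).mapId Y).inv := by
  simp [comparison]

/-- Strips the unit constraints from the cube used in `comparison_G`. By the exchange law `d`
cancels along one path and `e'` along the other; what remains of both paths has the same invertible
ends, made of `e` and `d'`. -/
theorem exchange_of_cube_left {x y z w : D} {q : x ⟶ z} {p : y ⟶ w} {a a' : z ⟶ w}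
    {b b' : x ⟶ y} {s r : w ⟶ w} {s' r' : y ⟶ y} (e : s ≅ 𝟙 w) (e' : s' ≅ 𝟙 y)
    (d : r ≅ 𝟙 w) (d' : r' ≅ 𝟙 y) (θ : a' ⟶ a) (θ' : b' ⟶ b) (G : q ≫ a ⟶ b ≫ p)
    (G' : q ≫ a' ⟶ b' ≫ p)
    (h : CubeCommutes (b := a) (q := a') (p := r) (a := s) (b' := b) (q' := b') (p' := r')
      (a' := s') (x := q) (y := p) (z := p) (w := p)
      (p ◁ d.hom ≫ (ρ_ p).hom ≫ (λ_ p).inv ≫ d'.inv ▷ p) G'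
      (p ◁ e.hom ≫ (ρ_ p).hom ≫ (λ_ p).inv ≫ e'.inv ▷ p) G
      (a' ◁ e.hom ≫ (ρ_ a').hom ≫ θ ≫ (ρ_ a).inv ≫ a ◁ d.inv)
      (b' ◁ e'.hom ≫ (ρ_ b').hom ≫ θ' ≫ (ρ_ b).inv ≫ b ◁ d'.inv)) :
    q ◁ θ ≫ G = G' ≫ θ' ▷ p := by
  have hl : q ◁ (a' ◁ e.hom ≫ (ρ_ a').hom ≫ θ ≫ (ρ_ a).inv ≫ a ◁ d.inv) ≫ (α_ q a r).inv ≫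
      G ▷ r ≫ (α_ b p r).hom ≫ b ◁ (p ◁ d.hom ≫ (ρ_ p).hom ≫ (λ_ p).inv ≫ d'.inv ▷ p) =
      q ◁ (a' ◁ e.hom ≫ (ρ_ a').hom) ≫ (q ◁ θ ≫ G) ≫ b ◁ ((λ_ p).inv ≫ d'.inv ▷ p) := by
    calc
      _ = 𝟙 _ ⊗≫ q ◁ a' ◁ e.hom ⊗≫ q ◁ θ ⊗≫ ((q ≫ a) ◁ d.inv ≫ G ▷ r) ⊗≫
            b ◁ p ◁ d.hom ⊗≫ b ◁ d'.inv ▷ p := by bicategory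
      _ = 𝟙 _ ⊗≫ q ◁ a' ◁ e.hom ⊗≫ q ◁ θ ⊗≫ G ⊗≫ (b ≫ p) ◁ (d.inv ≫ d.hom) ⊗≫
            b ◁ d'.inv ▷ p := by rw [whisker_exchange]; bicategory
      _ = _ := by rw [Iso.inv_hom_id]; bicategory
  have hr : (α_ q a' s).inv ≫ G' ▷ s ≫ (α_ b' p s).hom ≫
      b' ◁ (p ◁ e.hom ≫ (ρ_ p).hom ≫ (λ_ p).inv ≫ e'.inv ▷ p) ≫ (α_ b' s' p).inv ≫
      (b' ◁ e'.hom ≫ (ρ_ b').hom ≫ θ' ≫ (ρ_ b).inv ≫ b ◁ d'.inv) ▷ p ≫ (α_ b r' p).hom =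
      q ◁ (a' ◁ e.hom ≫ (ρ_ a').hom) ≫ (G' ≫ θ' ▷ p) ≫ b ◁ ((λ_ p).inv ≫ d'.inv ▷ p) := by
    calc
      _ = 𝟙 _ ⊗≫ (G' ▷ s ≫ (b' ≫ p) ◁ e.hom) ⊗≫ b' ◁ (e'.inv ≫ e'.hom) ▷ p ⊗≫ θ' ▷ p ⊗≫
            b ◁ d'.inv ▷ p := by bicategory
      _ = _ := by rw [← whisker_exchange, Iso.inv_hom_id]; bicategory
  have H := hl.symm.trans (Eq.trans h hr)
  rwa [cancel_epi, cancel_mono] at H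

/-- The analogue for the cube used in `G_comparison`: here `e` cancels along one path and `d'` along
the other, leaving common ends made of `e'` and `d`. -/
theorem exchange_of_cube_right {x y z w : D} {q q' : x ⟶ z} {p p' : y ⟶ w} {a : z ⟶ w}
    {b : x ⟶ y} {s r : w ⟶ w} {s' r' : z ⟶ z} (e : s ≅ 𝟙 w) (e' : s' ≅ 𝟙 z)
    (d : r ≅ 𝟙 w) (d' : r' ≅ 𝟙 z) (θ : p' ⟶ p) (θ' : q' ⟶ q) (G : q ≫ a ⟶ b ≫ p)
    (G' : q' ≫ a ⟶ b ≫ p')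
    (h : CubeCommutes (b := a) (q := s') (p := s) (a := a) (b' := b) (q' := q) (p' := p)
      (a' := a) (x := q') (y := p') (z := r') (w := r)
      (p' ◁ e.hom ≫ (ρ_ p').hom ≫ θ ≫ (ρ_ p).inv ≫ p ◁ d.inv)
      (q' ◁ e'.hom ≫ (ρ_ q').hom ≫ θ' ≫ (ρ_ q).inv ≫ q ◁ d'.inv)
      (d'.hom ▷ a ≫ (λ_ a).hom ≫ (ρ_ a).inv ≫ a ◁ d.inv) G'
      (e'.hom ▷ a ≫ (λ_ a).hom ≫ (ρ_ a).inv ≫ a ◁ e.inv) G) :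
    G' ≫ b ◁ θ = θ' ▷ a ≫ G := by
  have hl : q' ◁ (e'.hom ▷ a ≫ (λ_ a).hom ≫ (ρ_ a).inv ≫ a ◁ e.inv) ≫ (α_ q' a s).inv ≫
      G' ▷ s ≫ (α_ b p' s).hom ≫
      b ◁ (p' ◁ e.hom ≫ (ρ_ p').hom ≫ θ ≫ (ρ_ p).inv ≫ p ◁ d.inv) =
      q' ◁ (e'.hom ▷ a ≫ (λ_ a).hom) ≫ (G' ≫ b ◁ θ) ≫ b ◁ ((ρ_ p).inv ≫ p ◁ d.inv) := by
    calc
      _ = 𝟙 _ ⊗≫ q' ◁ e'.hom ▷ a ⊗≫ ((q' ≫ a) ◁ e.inv ≫ G' ▷ s) ⊗≫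
            b ◁ p' ◁ e.hom ⊗≫ b ◁ θ ⊗≫ b ◁ p ◁ d.inv := by bicategory
      _ = 𝟙 _ ⊗≫ q' ◁ e'.hom ▷ a ⊗≫ G' ⊗≫ (b ≫ p') ◁ (e.inv ≫ e.hom) ⊗≫
            b ◁ θ ⊗≫ b ◁ p ◁ d.inv := by rw [whisker_exchange]; bicategory
      _ = _ := by rw [Iso.inv_hom_id]; bicategory
  have hr : (α_ q' s' a).inv ≫
      (q' ◁ e'.hom ≫ (ρ_ q').hom ≫ θ' ≫ (ρ_ q).inv ≫ q ◁ d'.inv) ▷ a ≫ (α_ q r' a).hom ≫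
      q ◁ (d'.hom ▷ a ≫ (λ_ a).hom ≫ (ρ_ a).inv ≫ a ◁ d.inv) ≫ (α_ q a r).inv ≫
      G ▷ r ≫ (α_ b p r).hom =
      q' ◁ (e'.hom ▷ a ≫ (λ_ a).hom) ≫ (θ' ▷ a ≫ G) ≫ b ◁ ((ρ_ p).inv ≫ p ◁ d.inv) := by
    calc
      _ = 𝟙 _ ⊗≫ q' ◁ e'.hom ▷ a ⊗≫ θ' ▷ a ⊗≫ q ◁ (d'.inv ≫ d'.hom) ▷ a ⊗≫
            ((q ≫ a) ◁ d.inv ≫ G ▷ r) ⊗≫ 𝟙 _ := by bicategory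
      _ = _ := by rw [whisker_exchange, Iso.inv_hom_id]; bicategory
  have H := hl.symm.trans (Eq.trans h hr)
  rwa [cancel_epi, cancel_mono] at H

/-- The comparison isomorphisms intertwine `G i j` and `G i' j`. -/
theorem comparison_G {i i' j : ι} (h : A i ≤ A i') {X Y Z W : C} (b : (A i).Hom X Y)
    (q : (A j).Hom X Z) (p : (A j).Hom Y W) (a : (A i).Hom Z W)
    (α : q.hom ≫ a.hom ⟶ b.hom ≫ p.hom) :
    (S.F j).map q ◁ (S.comparison h a).hom ≫ (S.G i j b q p a α).hom =
      (S.G i' j (b.incl h) q p (a.incl h) α).hom ≫ (S.comparison h b).hom ▷ (S.F j).map p := by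
  -- Bottom and top are the comparison squares of `a` and `b`; left and back are the given square,
  -- seen in `A i'` and in `A i`; right and front are unit squares of the kind treated in
  -- `G_id_right`.
  have H := S.G_cube i i' j a (a.incl h) ((A i').id W) ((A i).id W)
    b (b.incl h) ((A i').id Y) ((A i).id Y) q p p p
    ((ρ_ _).hom ≫ (λ_ _).inv) α ((ρ_ _).hom ≫ (λ_ _).inv) α (𝟙 _) (𝟙 _) (by
      unfold CubeCommutes
      dsimp
      bicategory)
  erw [S.G_id_right, S.G_id_right, S.G_eq_comparison h, S.G_eq_comparison h] at H
  exact exchange_of_cube_left _ _ _ _ _ _ _ _ H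

/-- The comparison isomorphisms intertwine `G i j` and `G i j'`. -/
theorem G_comparison {i j j' : ι} (h : A j ≤ A j') {X Y Z W : C} (b : (A i).Hom X Y)
    (q : (A j).Hom X Z) (p : (A j).Hom Y W) (a : (A i).Hom Z W)
    (α : q.hom ≫ a.hom ⟶ b.hom ≫ p.hom) :
    (S.G i j' b (q.incl h) (p.incl h) a α).hom ≫ (S.F i).map b ◁ (S.comparison h p).hom =
      (S.comparison h q).hom ▷ (S.F i).map a ≫ (S.G i j b q p a α).hom := by
  -- Right and left are the comparison squares of `p` and `q`; back and top are the given square,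
  -- seen in `A j'` and in `A j`; the unit squares in front and at the bottom are of the kind in
  -- axiom (A).
  have H := S.G_cube i j j' a ((A j).id Z) ((A j).id W) a
    b q p a (q.incl h) (p.incl h) ((A j').id Z) ((A j').id W)
    (𝟙 _) (𝟙 _) ((λ_ _).hom ≫ (ρ_ _).inv) α ((λ_ _).hom ≫ (ρ_ _).inv) α (by
      unfold CubeCommutes
      dsimp
      bicategory)
  erw [S.G_of_id_id _ _ rfl, S.G_of_id_id _ _ rfl, S.G_eq_comparison h, S.G_eq_comparison h] at H
  exact exchange_of_cube_right _ _ _ _ _ _ _ _ H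

end GluingData

end Gluing

/-! ### Pseudonatural isomorphisms with identity components. -/

namespace Gluing

section IsoIcon

variable {C : Type u₁} [Bicategory.{w₁, v₁} C] {D : Type u₂} [Bicategory.{w₂, v₂} D]

/-- An invertible icon between pseudofunctors with the same object map: a pseudonatural
transformation with identity components, with the identities suppressed. -/
structure IsoIcon {A : ArrowySubcategory C} {obj : C → D} (F F' : PseudofunctorOn A obj) where
  /-- the component at a morphism -/
  app {X Y : C} (f : A.Hom X Y) : F.map f ≅ F'.map f
  naturality {X Y : C} {f g : A.Hom X Y} (η : f.hom ⟶ g.hom) :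
    F.map₂ η ≫ (app g).hom = (app f).hom ≫ F'.map₂ η
  app_id (X : C) : (app (A.id X)).hom ≫ (F'.mapId X).hom = (F.mapId X).hom
  app_comp {X Y Z : C} (f : A.Hom X Y) (g : A.Hom Y Z) :
    (app (f.comp g)).hom ≫ (F'.mapComp f g).hom =
      (F.mapComp f g).hom ≫ F.map f ◁ (app g).hom ≫ (app f).hom ▷ F'.map g

namespace IsoIcon

variable {A : ArrowySubcategory C} {obj : C → D} {F F' : PseudofunctorOn A obj}

/-- The inverse of an invertible icon. -/
@[reducible] def symm (t : IsoIcon F F') : IsoIcon F' F where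
  app f := (t.app f).symm
  naturality {X Y f g} η := by
    simp [← cancel_mono (t.app g).hom, t.naturality]
  app_id X := by simp [← t.app_id]
  app_comp f g := by
    have h := t.app_comp f g
    rw [← cancel_epi (t.app (f.comp g)).hom, reassoc_of% h]
    simp only [Iso.symm_hom, Iso.hom_inv_id_assoc]
    rw [← whisker_exchange_assoc]
    simp

/-- The pseudonatural transformation with identity components given by an invertible icon. -/
@[reducible] def toStrongTransOn (t : IsoIcon F F') :
    StrongTransOn F F' (fun X => 𝟙 (obj X)) where
  naturality f := ρ_ (F.map f) ≪≫ t.app f ≪≫ (λ_ (F'.map f)).symm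
  naturality_naturality η := by
    simp [reassoc_of% t.naturality η]
  naturality_id X := by simp [reassoc_of% t.app_id X, unitors_inv_equal]
  naturality_comp f g := by
    simp [reassoc_of% t.app_comp f g]

end IsoIcon

end IsoIcon

/-! ### Coherence of the comparison, and its naturality in the gluing datum. -/

namespace GluingData

variable {C : Type u₁} [Bicategory.{w₁, v₁} C] {ι : Type t}
  {A : ι → ArrowySubcategory C} {D : Type u₂} [Bicategory.{w₂, v₂} D] (S : GluingData A D)

theorem comparison_naturality {i j : ι} (h : A i ≤ A j) {X Y : C} {f g : (A i).Hom X Y}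
    (η : f.hom ⟶ g.hom) :
    (S.F j).map₂ (f := f.incl h) (g := g.incl h) η ≫ (S.comparison h g).hom =
      (S.comparison h f).hom ≫ (S.F i).map₂ η := by
  -- On the square given by `η` with identity sides, axiom (A) expresses both gluing 2-cells through
  -- the image of `η`.
  have H := S.comparison_G h (j := i) g ((A i).id X) ((A i).id Y) f
    ((λ_ _).hom ≫ η ≫ (ρ_ _).inv)
  rw [S.G_of_id η _ rfl] at H
  erw [S.G_of_id (a := f.incl h) (b := g.incl h) η _ rfl] at H
  simp only [Category.assoc] at H
  rw [whisker_exchange_assoc] at H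
  erw [whisker_exchange] at H
  rw [← cancel_epi (((S.F i).mapId X).hom ▷ _ ≫ (λ_ _).hom),
    ← cancel_mono ((ρ_ _).inv ≫ (S.F i).map g ◁ ((S.F i).mapId Y).inv)]
  simpa using H.symm

theorem comparison_id {i j : ι} (h : A i ≤ A j) (X : C) :
    (S.comparison h ((A i).id X)).hom =
      ((S.F j).mapId X).hom ≫ ((S.F i).mapId X).inv := by
  have H := S.G_of_id_id (i := i) (j := j) ((A i).id X) (𝟙 _) (by simp [unitors_equal])
  simp only [comparison, Iso.trans_hom, Iso.symm_hom, whiskerLeftIso_hom]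
  erw [H]
  simp [whisker_exchange_assoc]

/-- Expresses the composition constraint as a value of `G i i`, up to unit constraints, so that
rules about `G` yield rules about `mapComp`. It is axiom (O) combined with the right unit coherence
of `F i`. -/
theorem G_self_rightUnitor {i : ι} {X Y Z : C} (f : (A i).Hom X Y) (g : (A i).Hom Y Z) :
    (S.G i i (f.comp g) f ((A i).id Z) g (ρ_ _).inv).hom =
      ((S.F i).mapComp f g).inv ≫ (ρ_ _).inv ≫
        (S.F i).map (f.comp g) ◁ ((S.F i).mapId Z).inv := by
  have H := S.G_self i (f.comp g) f ((A i).id Z) g (ρ_ _).inv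
  have hρ := (S.F i).map₂_right_unitor (f.comp g)
  have hc := (S.F i).map₂_comp (f := f.comp g) (g := (f.comp g).comp ((A i).id Z))
    (h := f.comp g) (ρ_ _).inv (ρ_ _).hom
  rw [Iso.inv_hom_id, (S.F i).map₂_id (f.comp g), hρ] at hc
  rw [← cancel_epi ((S.F i).mapComp f g).hom, H,
    ← cancel_mono ((S.F i).map (f.comp g) ◁ ((S.F i).mapId Z).hom ≫ (ρ_ _).hom)]
  simpa using hc.symm

/-- One square, with sides `f`, `g`, `f ≫ g` and an identity, is evaluated by `G j j`, `G i j` and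
`G i i` in turn. `comparison_G` relates the first two, `G_comparison` the last two, and the outer
two are composition constraints by `G_self_rightUnitor`. -/
theorem comparison_comp {i j : ι} (h : A i ≤ A j) {X Y Z : C} (f : (A i).Hom X Y)
    (g : (A i).Hom Y Z) :
    (S.comparison h (f.comp g)).hom ≫ ((S.F i).mapComp f g).hom =
      ((S.F j).mapComp (f.incl h) (g.incl h)).hom ≫
        (S.F j).map (f.incl h) ◁ (S.comparison h g).hom ≫
        (S.comparison h f).hom ▷ (S.F i).map g := by
  have H₁ := S.comparison_G h (f.comp g) (f.incl h) ((A j).id Z) g (ρ_ _).inv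
  have H₂ := S.G_comparison h (f.comp g) f ((A i).id Z) g (ρ_ _).inv
  have H := H₁ =≫ ((S.F i).map (f.comp g) ◁ (S.comparison h ((A i).id Z)).hom)
  rw [Category.assoc] at H
  erw [H₂, S.G_self_rightUnitor (f.incl h) (g.incl h)] at H
  rw [S.G_self_rightUnitor, S.comparison_id] at H
  simp only [Category.assoc] at H
  erw [whisker_exchange_assoc, whisker_exchange_assoc] at H
  rw [← cancel_epi ((S.F j).mapComp (f.incl h) (g.incl h)).inv,
    ← cancel_mono (((S.F i).mapComp f g).inv ≫ (ρ_ _).inv ≫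
        (S.F i).map (f.comp g) ◁ ((S.F i).mapId Z).inv), whisker_exchange]
  simpa using H.symm

/-- Strips the unit constraints from the hexagon of a morphism at a comparison square. By exchange
`e'` cancels on the left-hand side and `d` on the right-hand side, leaving common ends made of `e`
and `d'`. -/
theorem hom_comparison_of_hexagon {x y x' y' : D} {f g : x ⟶ y} {f' g' : x' ⟶ y'} {u : x ⟶ x'}
    {v : y ⟶ y'} {r s : y ⟶ y} {r' s' : y' ⟶ y'} (e : s ≅ 𝟙 y) (e' : s' ≅ 𝟙 y')
    (d : r ≅ 𝟙 y) (d' : r' ≅ 𝟙 y') (θ : g ⟶ f) (θ' : g' ⟶ f') (σ : f ≫ v ⟶ u ≫ f')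
    (τ : g ≫ v ⟶ u ≫ g')
    (h : (α_ _ _ _).hom ≫ g ◁ (e.hom ▷ v ≫ (λ_ v).hom ≫ (ρ_ v).inv ≫ v ◁ e'.inv) ≫
        (α_ _ _ _).inv ≫ τ ▷ s' ≫ (α_ _ _ _).hom ≫
        u ◁ (g' ◁ e'.hom ≫ (ρ_ g').hom ≫ θ' ≫ (ρ_ f').inv ≫ f' ◁ d'.inv) =
      (g ◁ e.hom ≫ (ρ_ g).hom ≫ θ ≫ (ρ_ f).inv ≫ f ◁ d.inv) ▷ v ≫ (α_ _ _ _).hom ≫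
        f ◁ (d.hom ▷ v ≫ (λ_ v).hom ≫ (ρ_ v).inv ≫ v ◁ d'.inv) ≫ (α_ _ _ _).inv ≫
        σ ▷ r' ≫ (α_ _ _ _).hom) :
    θ ▷ v ≫ σ = τ ≫ u ◁ θ' := by
  have hl : (α_ _ _ _).hom ≫ g ◁ (e.hom ▷ v ≫ (λ_ v).hom ≫ (ρ_ v).inv ≫ v ◁ e'.inv) ≫
        (α_ _ _ _).inv ≫ τ ▷ s' ≫ (α_ _ _ _).hom ≫
        u ◁ (g' ◁ e'.hom ≫ (ρ_ g').hom ≫ θ' ≫ (ρ_ f').inv ≫ f' ◁ d'.inv) =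
      (g ◁ e.hom ≫ (ρ_ g).hom) ▷ v ≫ (τ ≫ u ◁ θ') ≫ u ◁ ((ρ_ f').inv ≫ f' ◁ d'.inv) := by
    calc
      _ = 𝟙 _ ⊗≫ g ◁ e.hom ▷ v ⊗≫ ((g ≫ v) ◁ e'.inv ≫ τ ▷ s') ⊗≫
            u ◁ g' ◁ e'.hom ⊗≫ u ◁ θ' ⊗≫ u ◁ f' ◁ d'.inv := by bicategory
      _ = 𝟙 _ ⊗≫ g ◁ e.hom ▷ v ⊗≫ τ ⊗≫ (u ≫ g') ◁ (e'.inv ≫ e'.hom) ⊗≫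
            u ◁ θ' ⊗≫ u ◁ f' ◁ d'.inv := by rw [whisker_exchange]; bicategory
      _ = _ := by rw [Iso.inv_hom_id]; bicategory
  have hr : (g ◁ e.hom ≫ (ρ_ g).hom ≫ θ ≫ (ρ_ f).inv ≫ f ◁ d.inv) ▷ v ≫ (α_ _ _ _).hom ≫
        f ◁ (d.hom ▷ v ≫ (λ_ v).hom ≫ (ρ_ v).inv ≫ v ◁ d'.inv) ≫ (α_ _ _ _).inv ≫
        σ ▷ r' ≫ (α_ _ _ _).hom =
      (g ◁ e.hom ≫ (ρ_ g).hom) ▷ v ≫ (θ ▷ v ≫ σ) ≫ u ◁ ((ρ_ f').inv ≫ f' ◁ d'.inv) := by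
    calc
      _ = 𝟙 _ ⊗≫ g ◁ e.hom ▷ v ⊗≫ θ ▷ v ⊗≫ f ◁ (d.inv ≫ d.hom) ▷ v ⊗≫
            ((f ≫ v) ◁ d'.inv ≫ σ ▷ r') ⊗≫ 𝟙 _ := by bicategory
      _ = _ := by rw [whisker_exchange, Iso.inv_hom_id]; bicategory
  have H := hl.symm.trans (h.trans hr)
  rw [cancel_epi, cancel_mono] at H
  exact H.symm

/-- The comparison isomorphisms are compatible with morphisms of gluing data. -/
theorem comparison_hom {S T : GluingData A D} (σ : Hom S T) {i j : ι} (h : A i ≤ A j) {X Y : C}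
    (f : (A i).Hom X Y) :
    (S.comparison h f).hom ▷ σ.app Y ≫ ((σ.trans i).naturality f).hom =
      ((σ.trans j).naturality (f.incl h)).hom ≫ σ.app X ◁ (T.comparison h f).hom := by
  have H := σ.hexagon i j f (f.incl h) ((A j).id Y) ((A i).id Y) (𝟙 _)
  erw [S.G_eq_comparison h, T.G_eq_comparison h, (σ.trans i).naturality_id_hom,
    (σ.trans j).naturality_id_hom] at H
  exact hom_comparison_of_hexagon _ _ _ _ _ _ _ _ H

end GluingData

end Gluing

/-! ### Comparison morphisms between a gluing datum and its reindexing. -/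

namespace Gluing

/-- A 2-cell of `D^S` whose components are given by equalities is heterogeneously equal to an
identity 2-cell. -/
theorem Pow.heq_id {D : Type u₂} [Bicategory.{w₂, v₂} D] {S : Type u₁} {F F' : Pow D S}
    {f g k : F ⟶ F'} (η : f ⟶ g) (hf : f = k) (hg : g = k)
    (h : ∀ X, η.app X = eqToHom (by rw [hf, hg])) : HEq η (𝟙 k) := by
  subst hf hg
  exact heq_of_eq (Pow.Hom₂.ext (funext h))

namespace OverFunctor

variable {D : Type u₁} [Bicategory.{w₁, v₁} D]
  {B : Type u₂} [Bicategory.{w₂, v₂} B] {C : Type u₃} [Bicategory.{w₃, v₃} C]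
  {E : StrictPseudofunctor B D} {F : StrictPseudofunctor C D}

theorem ext_functor {G H : OverFunctor E F}
    (h : G.functor.toPrelaxFunctor = H.functor.toPrelaxFunctor) : G = H := by
  obtain ⟨G, _⟩ := G
  obtain ⟨H, _⟩ := H
  obtain rfl : G = H := strictPseudofunctor_ext h
  rfl

end OverFunctor

namespace GluingData

variable {C : Type u₁} [Bicategory.{w₁, v₁} C] {ι : Type t}
  {A : ι → ArrowySubcategory C} {D : Type u₂} [Bicategory.{w₂, v₂} D]

/-- The comparison isomorphisms form an invertible icon. -/
@[reducible] def comparisonIcon (S : GluingData A D) {i j : ι} (h : A i ≤ A j) :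
    IsoIcon ((S.F j).restrict h) (S.F i) where
  app f := S.comparison h f
  naturality η := S.comparison_naturality h η
  app_id X := by
    rw [comparison_id]
    simp
  app_comp f g := S.comparison_comp h f g

/-- The comparison isomorphisms intertwine `G i j` and `G i' j'`. -/
theorem comparison_hexagon (S : GluingData A D) {i i' j j' : ι} (hi : A i ≤ A i')
    (hj : A j ≤ A j') {X Y Z W : C} (b : (A i).Hom X Y) (q : (A j).Hom X Z) (p : (A j).Hom Y W)
    (a : (A i).Hom Z W) (α : q.hom ≫ a.hom ⟶ b.hom ≫ p.hom) :
    (S.F j').map (q.incl hj) ◁ (S.comparison hi a).hom ≫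
        (S.comparison hj q).hom ▷ (S.F i).map a ≫ (S.G i j b q p a α).hom =
      (S.G i' j' (b.incl hi) (q.incl hj) (p.incl hj) (a.incl hi) α).hom ≫
        (S.F i').map (b.incl hi) ◁ (S.comparison hj p).hom ≫
        (S.comparison hi b).hom ▷ (S.F j).map p := by
  rw [← S.G_comparison hj, whisker_exchange]
  have h := S.comparison_G hi b (q.incl hj) (p.incl hj) a α
  rw [reassoc_of% h]

variable (ψ : ι → ι) (h : ∀ i, A i ≤ A (ψ i))

/-- The comparison morphism from a reindexed gluing datum. -/
@[reducible] def fromReindex (S : GluingData A D) : Hom (reindexObj ψ h S) S where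
  app X := 𝟙 (S.obj X)
  trans i := (S.comparisonIcon (h i)).toStrongTransOn
  hexagon i j X Y Z W b q p a α := by
    have H := S.comparison_hexagon (h i) (h j) b q p a α
    simp [reassoc_of% H]

/-- The comparison morphism to a reindexed gluing datum. -/
@[reducible] def toReindex (S : GluingData A D) : Hom S (reindexObj ψ h S) where
  app X := 𝟙 (S.obj X)
  trans i := (S.comparisonIcon (h i)).symm.toStrongTransOn
  hexagon i j X Y Z W b q p a α := by
    have H := S.comparison_hexagon (h i) (h j) b q p a α
    -- This is `H` with the comparisons moved to the other side; the exchange law puts them in the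
    -- order required by the hexagon.
    have H' : (S.F j).map q ◁ (S.comparison (h i) a).inv ≫
        (S.comparison (h j) q).inv ▷ (S.F (ψ i)).map (a.incl (h i)) ≫
        (S.G (ψ i) (ψ j) (b.incl (h i)) (q.incl (h j)) (p.incl (h j)) (a.incl (h i)) α).hom =
      (S.G i j b q p a α).hom ≫ (S.F i).map b ◁ (S.comparison (h j) p).inv ≫
        (S.comparison (h i) b).inv ▷ (S.F (ψ j)).map (p.incl (h j)) := by
      rw [← cancel_epi ((S.comparison (h j) q).hom ▷ (S.F i).map a),
        ← cancel_epi ((S.F (ψ j)).map (q.incl (h j)) ◁ (S.comparison (h i) a).hom),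
        reassoc_of% H, ← whisker_exchange_assoc]
      rw [whisker_exchange_assoc (S.comparison (h i) b).hom]
      simp
    simp [reassoc_of% H']

/-- The naturality constraint of `fromReindex`. -/
def fromReindexNaturality {S T : GluingData A D} (σ : Hom S T) :
    (reindexHom ψ h σ).comp (fromReindex ψ h T) ≅ (fromReindex ψ h S).comp σ :=
  Hom.isoMk (fun X => ρ_ (σ.app X) ≪≫ (λ_ (σ.app X)).symm) fun i X Y f => by
    simp [← reassoc_of% S.comparison_hom σ (h i) f]

/-- The naturality constraint of `toReindex`. -/
def toReindexNaturality {S T : GluingData A D} (σ : Hom S T) :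
    σ.comp (toReindex ψ h T) ≅ (toReindex ψ h S).comp (reindexHom ψ h σ) :=
  Hom.isoMk (fun X => ρ_ (σ.app X) ≪≫ (λ_ (σ.app X)).symm) fun i X Y f => by
    have H : (S.comparison (h i) f).inv ▷ σ.app Y ≫
        ((σ.trans (ψ i)).naturality (f.incl (h i))).hom =
        ((σ.trans i).naturality f).hom ≫ σ.app X ◁ (T.comparison (h i) f).inv := by
      rw [← cancel_epi ((S.comparison (h i) f).hom ▷ σ.app Y),
        reassoc_of% S.comparison_hom σ (h i) f]
      simp
    simp [← reassoc_of% H]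

/-- `fromReindex` followed by `toReindex` is isomorphic to the identity. -/
def fromReindexCompToReindex (S : GluingData A D) :
    (fromReindex ψ h S).comp (toReindex ψ h S) ≅ Hom.id (reindexObj ψ h S) :=
  Hom.isoMk (fun X => λ_ (𝟙 (S.obj X))) fun i X Y f => by simp

/-- `toReindex` followed by `fromReindex` is isomorphic to the identity. -/
def toReindexCompFromReindex (S : GluingData A D) :
    (toReindex ψ h S).comp (fromReindex ψ h S) ≅ Hom.id S :=
  Hom.isoMk (fun X => λ_ (𝟙 (S.obj X))) fun i X Y f => by simp

/-! ### The equivalences over `D^{Ob C}`. -/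

variable [Strict D]

/-- The pseudonatural transformation from reindexing to the identity. -/
def fromReindexTrans :
    (Q D ψ h).toPs ⟶ (OverFunctor.id (forget A D)).toPs where
  app S := fromReindex ψ h S
  naturality {S T} σ := fromReindexNaturality ψ h σ
  naturality_naturality η := Hom₂.ext (funext fun X => by
    -- 2-cells of gluing data compose and whisker componentwise, so each axiom of a pseudonatural
    -- transformation becomes a coherence statement about unitors in `D`.
    change Hom₂.app η X ▷ 𝟙 _ ≫ (ρ_ _).hom ≫ (λ_ _).inv =
      ((ρ_ _).hom ≫ (λ_ _).inv) ≫ 𝟙 _ ◁ Hom₂.app η X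
    simp)
  naturality_id S := Hom₂.ext (funext fun X => by
    change ((ρ_ (𝟙 (S.obj X))).hom ≫ (λ_ (𝟙 (S.obj X))).inv) ≫ 𝟙 (S.obj X) ◁ 𝟙 _ =
      𝟙 _ ▷ 𝟙 (S.obj X) ≫ (λ_ _).hom ≫ (ρ_ _).inv
    simp [unitors_equal, unitors_inv_equal])
  naturality_comp {S T U} σ τ := Hom₂.ext (funext fun X => by
    change ((ρ_ (Hom.app σ X ≫ Hom.app τ X)).hom ≫ (λ_ _).inv) ≫ 𝟙 (S.obj X) ◁ 𝟙 _ =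
      𝟙 _ ▷ 𝟙 (U.obj X) ≫ (α_ _ _ _).hom ≫
        Hom.app σ X ◁ ((ρ_ (Hom.app τ X)).hom ≫ (λ_ _).inv) ≫ (α_ _ _ _).inv ≫
        ((ρ_ (Hom.app σ X)).hom ≫ (λ_ _).inv) ▷ Hom.app τ X ≫ (α_ _ _ _).hom
    simp)

/-- The pseudonatural transformation from the identity to reindexing. -/
def toReindexTrans :
    (OverFunctor.id (forget A D)).toPs ⟶ (Q D ψ h).toPs where
  app S := toReindex ψ h S
  naturality {S T} σ := toReindexNaturality ψ h σ
  naturality_naturality η := Hom₂.ext (funext fun X => by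
    change Hom₂.app η X ▷ 𝟙 _ ≫ (ρ_ _).hom ≫ (λ_ _).inv =
      ((ρ_ _).hom ≫ (λ_ _).inv) ≫ 𝟙 _ ◁ Hom₂.app η X
    simp)
  naturality_id S := Hom₂.ext (funext fun X => by
    change ((ρ_ (𝟙 (S.obj X))).hom ≫ (λ_ (𝟙 (S.obj X))).inv) ≫ 𝟙 (S.obj X) ◁ 𝟙 _ =
      𝟙 _ ▷ 𝟙 (S.obj X) ≫ (λ_ _).hom ≫ (ρ_ _).inv
    simp [unitors_equal, unitors_inv_equal])
  naturality_comp {S T U} σ τ := Hom₂.ext (funext fun X => by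
    change ((ρ_ (Hom.app σ X ≫ Hom.app τ X)).hom ≫ (λ_ _).inv) ≫ 𝟙 (S.obj X) ◁ 𝟙 _ =
      𝟙 _ ▷ 𝟙 (U.obj X) ≫ (α_ _ _ _).hom ≫
        Hom.app σ X ◁ ((ρ_ (Hom.app τ X)).hom ≫ (λ_ _).inv) ≫ (α_ _ _ _).inv ≫
        ((ρ_ (Hom.app σ X)).hom ≫ (λ_ _).inv) ▷ Hom.app τ X ≫ (α_ _ _ _).hom
    simp)

/-- The constraint at `σ` projects to right unitors followed by inverse left unitors. In a strict
`D` both are given by equalities, which is what heterogeneous equality with an identity requires. -/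
theorem isOverNatural_fromReindexTrans :
    OverFunctor.IsOverNatural (G := Q D ψ h) (H := OverFunctor.id (forget A D))
      (fromReindexTrans ψ h) where
  map_app S := HEq.rfl
  map₂_naturality σ :=
    Pow.heq_id _ (Pow.Hom.ext (funext fun X => Strict.comp_id (Hom.app σ X)))
      (Pow.Hom.ext (funext fun X => Strict.id_comp (Hom.app σ X))) fun X => by
    change (ρ_ (Hom.app σ X)).hom ≫ (λ_ (Hom.app σ X)).inv = _
    simp only [Strict.rightUnitor_eqToIso, Strict.leftUnitor_eqToIso, eqToIso.hom, eqToIso.inv,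
      eqToHom_trans]
    rfl

theorem isOverNatural_toReindexTrans :
    OverFunctor.IsOverNatural (G := OverFunctor.id (forget A D)) (H := Q D ψ h)
      (toReindexTrans ψ h) where
  map_app S := HEq.rfl
  map₂_naturality σ :=
    Pow.heq_id _ (Pow.Hom.ext (funext fun X => Strict.comp_id (Hom.app σ X)))
      (Pow.Hom.ext (funext fun X => Strict.id_comp (Hom.app σ X))) fun X => by
    change (ρ_ (Hom.app σ X)).hom ≫ (λ_ (Hom.app σ X)).inv = _
    simp only [Strict.rightUnitor_eqToIso, Strict.leftUnitor_eqToIso, eqToIso.hom, eqToIso.inv,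
      eqToHom_trans]
    rfl

/-- `fromReindexTrans` followed by `toReindexTrans` is isomorphic to the identity. -/
def fromToIso : fromReindexTrans (D := D) ψ h ≫ toReindexTrans ψ h ≅ 𝟙 (Q D ψ h).toPs :=
  Pseudofunctor.StrongTrans.isoMk
    (fun S => fromReindexCompToReindex ψ h S)
    fun {S T} σ => Hom₂.ext (funext fun X => by
      change Hom.app σ X ◁ (λ_ (𝟙 (T.obj X))).hom ≫ (ρ_ _).hom ≫ (λ_ _).inv =
        ((α_ _ _ _).inv ≫ ((ρ_ _).hom ≫ (λ_ _).inv) ▷ 𝟙 (T.obj X) ≫ (α_ _ _ _).hom ≫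
          𝟙 (S.obj X) ◁ ((ρ_ _).hom ≫ (λ_ _).inv) ≫ (α_ _ _ _).inv) ≫
          (λ_ (𝟙 (S.obj X))).hom ▷ Hom.app σ X
      simp)

/-- `toReindexTrans` followed by `fromReindexTrans` is isomorphic to the identity. -/
def toFromIso :
    toReindexTrans (D := D) ψ h ≫ fromReindexTrans ψ h ≅ 𝟙 (OverFunctor.id (forget A D)).toPs :=
  Pseudofunctor.StrongTrans.isoMk
    (fun S => toReindexCompFromReindex ψ h S)
    fun {S T} σ => Hom₂.ext (funext fun X => by
      change Hom.app σ X ◁ (λ_ (𝟙 (T.obj X))).hom ≫ (ρ_ _).hom ≫ (λ_ _).inv =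
        ((α_ _ _ _).inv ≫ ((ρ_ _).hom ≫ (λ_ _).inv) ▷ 𝟙 (T.obj X) ≫ (α_ _ _ _).hom ≫
          𝟙 (S.obj X) ◁ ((ρ_ _).hom ≫ (λ_ _).inv) ≫ (α_ _ _ _).inv) ≫
          (λ_ (𝟙 (S.obj X))).hom ▷ Hom.app σ X
      simp)

theorem isOverModification_fromToIso :
    OverFunctor.IsOverModification (G := Q D ψ h) (H := Q D ψ h) (fromToIso ψ h).hom ∧
    OverFunctor.IsOverModification (G := Q D ψ h) (H := Q D ψ h) (fromToIso ψ h).inv := by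
  constructor
  · intro S
    refine Pow.heq_id _
      (Pow.Hom.ext (funext fun X => Strict.comp_id (𝟙 (S.obj X)))) rfl fun X => ?_
    exact congrArg Iso.hom (Strict.leftUnitor_eqToIso (𝟙 (S.obj X)))
  · intro S
    refine Pow.heq_id _ rfl
      (Pow.Hom.ext (funext fun X => Strict.comp_id (𝟙 (S.obj X)))) fun X => ?_
    exact congrArg Iso.inv (Strict.leftUnitor_eqToIso (𝟙 (S.obj X)))

theorem isOverModification_toFromIso :
    OverFunctor.IsOverModification (G := OverFunctor.id (forget A D))
      (H := OverFunctor.id (forget A D)) (toFromIso ψ h).hom ∧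
    OverFunctor.IsOverModification (G := OverFunctor.id (forget A D))
      (H := OverFunctor.id (forget A D)) (toFromIso ψ h).inv := by
  constructor
  · intro S
    refine Pow.heq_id _
      (Pow.Hom.ext (funext fun X => Strict.comp_id (𝟙 (S.obj X)))) rfl fun X => ?_
    exact congrArg Iso.hom (Strict.leftUnitor_eqToIso (𝟙 (S.obj X)))
  · intro S
    refine Pow.heq_id _ rfl
      (Pow.Hom.ext (funext fun X => Strict.comp_id (𝟙 (S.obj X)))) fun X => ?_
    exact congrArg Iso.inv (Strict.leftUnitor_eqToIso (𝟙 (S.obj X)))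

theorem isOverNaturalEquivalence_fromReindexTrans :
    OverFunctor.IsOverNaturalEquivalence (G := Q D ψ h) (H := OverFunctor.id (forget A D))
      (fromReindexTrans ψ h) :=
  ⟨isOverNatural_fromReindexTrans ψ h, toReindexTrans ψ h, isOverNatural_toReindexTrans ψ h,
    fromToIso ψ h, toFromIso ψ h, (isOverModification_fromToIso ψ h).1,
    (isOverModification_fromToIso ψ h).2, (isOverModification_toFromIso ψ h).1,
    (isOverModification_toFromIso ψ h).2⟩

theorem isOverNaturalEquivalence_toReindexTrans :
    OverFunctor.IsOverNaturalEquivalence (G := OverFunctor.id (forget A D)) (H := Q D ψ h)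
      (toReindexTrans ψ h) :=
  ⟨isOverNatural_toReindexTrans ψ h, fromReindexTrans ψ h, isOverNatural_fromReindexTrans ψ h,
    toFromIso ψ h, fromToIso ψ h, (isOverModification_toFromIso ψ h).1,
    (isOverModification_toFromIso ψ h).2, (isOverModification_fromToIso ψ h).1,
    (isOverModification_fromToIso ψ h).2⟩

/-- Reindexing is functorial in the map of index sets. -/
theorem Q_comp_Q {κ μ : Type*} {B : κ → ArrowySubcategory C} {B' : μ → ArrowySubcategory C}
    (φ : ι → κ) (hφ : ∀ i, A i ≤ B (φ i)) (χ : κ → μ) (hχ : ∀ k, B k ≤ B' (χ k))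
    (hc : ∀ i, A i ≤ B' (χ (φ i))) :
    (Q D χ hχ).comp (Q D φ hφ) = Q D (fun i => χ (φ i)) hc :=
  OverFunctor.ext_functor rfl

end GluingData

end Gluing

/-- Let `C` be a (2,1)-category with arrowy 2-subcategories `A 1, …, A n`, let `D` be a 2-category,
and let `φ : {1, …, n} → {1, …, m}` be a map with a section `φ'` such that `A i ⊆ A (φ' (φ i))` for
all `i`. Then the reindexing 2-functors `Q^φ` and `Q^φ'` between the 2-categories of gluing data
relative to `A (φ' 1), …, A (φ' m)` and relative to `A 1, …, A n` are
`D^{Ob C}`-quasi-inverses of each other. -/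
theorem propositionp {C : Type u₁} [Bicategory.{w₁, v₁} C] [Strict C] [IsLocallyGroupoid C]
    {D : Type u₂} [Bicategory.{w₂, v₂} D] [Strict D] {n m : ℕ} (hn : 1 ≤ n)
    (A : Fin n → Gluing.ArrowySubcategory C) (φ : Fin n → Fin m) (φ' : Fin m → Fin n)
    (hφ : ∀ j, φ (φ' j) = j) (hA : ∀ i, A i ≤ A (φ' (φ i))) :
    Gluing.OverFunctor.AreQuasiInverse
      (Gluing.GluingData.Q D (A := A) (B := fun j => A (φ' j)) φ hA)
      (Gluing.GluingData.Q D (A := fun j => A (φ' j)) (B := A) φ'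
        (fun j => (A (φ' j)).le_refl)) := by
  refine ⟨?_, ?_⟩
  · rw [Gluing.GluingData.Q_comp_Q φ hA φ' (fun j => (A (φ' j)).le_refl) hA]
    exact ⟨_, Gluing.GluingData.isOverNaturalEquivalence_toReindexTrans (fun i => φ' (φ i)) hA⟩
  -- The same comparison applies to the family `A ∘ φ'` and the self-map `φ ∘ φ'`; the required
  -- inclusion is `hA` at the index `φ' j`.
  · have hc : ∀ j, A (φ' j) ≤ A (φ' (φ (φ' j))) := fun j => hA _
    rw [Gluing.GluingData.Q_comp_Q (B' := fun j => A (φ' j)) φ'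
      (fun j => (A (φ' j)).le_refl) φ hA hc]
    exact ⟨_, Gluing.GluingData.isOverNaturalEquivalence_fromReindexTrans
      (A := fun j => A (φ' j)) (fun j => φ (φ' j)) hc⟩
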